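/- Let $\alpha=(\alpha_n)_{n\ge 1}$ be a strictly increasing sequence of positive real numbers with $\alpha_n\to\infty$, and let $(s_k)_{k\ge1}\subset(1,\infty)$ be strictly increasing with $s_k\to\infty$. For $k\in\mathbb N$ let $v_k(n):=s_k^{-\alpha_n}$ and let $c_0(v_k)$ be the Banach space of all $x=(x_n)\in\mathbb C^{\mathbb N}$ with $v_k(n)|x_n|\to0$, normed by $\sup_n v_k(n)|x_n|$. Let $E_\alpha:=\operatorname{ind}_k c_0(v_k)$ be the union $\bigcup_k c_0(v_k)$ with the finest locally convex Hausdorff topology for which all inclusions $c_0(v_k)\hookrightarrow E_\alpha$ are continuous. Let $\mathsf C\in\mathcal L(E_\alpha)$ be the Cesàro operator $(\mathsf Cx)_n=\frac1n\sum_{m=1}^n x_m$. Denote by $\sigma(\mathsf C;E_\alpha)$ the complement in $\mathbb C$ of the resolvent set $\rho(\mathsf C;E_\alpha)$ of all $\lambda$ for which $R(\lambda,\mathsf C)=(\lambda I-\mathsf C)^{-1}$ exists in $\mathcal L(E_\alpha)$, and by $\sigma^*(\mathsf C;E_\alpha)$ the complement of the set of all $\lambda$ for which there is $\delta>0$ such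 that $B(\lambda,\delta)=\{\mu\in\mathbb C:|\mu-\lambda|<\delta\}\subset\rho(\mathsf C;E_\alpha)$ and $\{R(\mu,\mathsf C):\mu\in B(\lambda,\delta)\}$ is equicontinuous in $\mathcal L(E_\alpha)$. Put $D(1):=\{\lambda\in\mathbb C:|\lambda-\frac12|<\frac12\}$. Suppose that $E_\alpha$ is not a nuclear space. (i) If $\sup_{n\ge 2}\frac{\log(\log n)}{\alpha_n}<\infty$, then $\sigma(\mathsf C;E_\alpha)=\{0,1\}\cup D(1)$ and $\sigma^*(\mathsf C;E_\alpha)=\overline{D(1)}$. (ii) If $\sup_{n\ge 2}\frac{\log(\log n)}{\alpha_n}=\infty$, then $\sigma(\mathsf C;E_\alpha)=\sigma^*(\mathsf C;E_\alpha)=\overline{D(1)}$. -/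

import Mathlib

open Filter Topology Set

noncomputable section

/-! ### Nuclear locally convex spaces -/

/-- A bounded operator `T : X → Y` between Banach spaces is nuclear if
`T x = ∑ fⱼ(x) yⱼ` with `fⱼ ∈ X'`, `yⱼ ∈ Y` and `∑ ‖fⱼ‖ ‖yⱼ‖ < ∞`. -/
def IsNuclearMap {X Y : Type*} [NormedAddCommGroup X] [NormedSpace ℂ X]
    [NormedAddCommGroup Y] [NormedSpace ℂ Y] (T : X →L[ℂ] Y) : Prop :=
  ∃ (f : ℕ → X →L[ℂ] ℂ) (y : ℕ → Y),
    Summable (fun j => ‖f j‖ * ‖y j‖) ∧ ∀ x, HasSum (fun j => f j x • y j) (T x)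

section LocalBanach

variable {X : Type*} [AddCommGroup X] [Module ℂ X]

/-- A copy of `X` carrying the topology of the single seminorm `p`. -/
def SeminormSpace (_p : Seminorm ℂ X) : Type _ := X

instance (p : Seminorm ℂ X) : SeminormedAddCommGroup (SeminormSpace p) :=
  p.toAddGroupSeminorm.toSeminormedAddCommGroup

instance (p : Seminorm ℂ X) : Module ℂ (SeminormSpace p) := inferInstanceAs (Module ℂ X)

instance (p : Seminorm ℂ X) : NormedSpace ℂ (SeminormSpace p) where
  norm_smul_le c x := le_of_eq (map_smul_eq_mul p c x)

/-- The local Banach space `X_p`: the Hausdorff completion of `(X, p)`, i.e. the completion of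
`X / ker p` for the norm induced by `p`. -/
abbrev LocalBanach (p : Seminorm ℂ X) : Type _ := UniformSpace.Completion (SeminormSpace p)

/-- The identity `(X, q) → (X, p)` for `p ≤ q`. -/
def seminormSpaceMap {p q : Seminorm ℂ X} (h : p ≤ q) : SeminormSpace q →L[ℂ] SeminormSpace p :=
  LinearMap.mkContinuous (σ := RingHom.id ℂ) (E := SeminormSpace q) (F := SeminormSpace p)
    (LinearMap.id (R := ℂ) (M := X)) 1 (fun x => (h x).trans_eq (one_mul _).symm)

/-- The canonical map `X_q → X_p` for `p ≤ q`. -/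
def localBanachMap {p q : Seminorm ℂ X} (h : p ≤ q) : LocalBanach q →L[ℂ] LocalBanach p :=
  (seminormSpaceMap h).completion

end LocalBanach

/-- A locally convex space `X` is nuclear if every continuous seminorm `p` is dominated by a
continuous seminorm `q` for which the canonical map `X_q → X_p` is nuclear. -/
def IsNuclearSpace (X : Type*) [AddCommGroup X] [Module ℂ X] [TopologicalSpace X] : Prop :=
  ∀ p : Seminorm ℂ X, Continuous p →
    ∃ (q : Seminorm ℂ X) (h : p ≤ q), Continuous q ∧ IsNuclearMap (localBanachMap h)

/-! ### The spectrum `σ*`; the spectrum `σ` is Mathlib's `spectrum ℂ` -/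

section StarSpectrum

variable {X : Type*} [AddCommGroup X] [Module ℂ X] [TopologicalSpace X]
  [IsTopologicalAddGroup X] [ContinuousSMul ℂ X]

/-- `ρ*(T)`: all `z` such that some open disc `B(z, δ)` is contained in `ρ(T)` and
`{R(μ, T) : μ ∈ B(z, δ)}` is an equicontinuous set of linear operators. -/
def starResolventSet (T : X →L[ℂ] X) : Set ℂ :=
  {z | ∃ δ > 0, Metric.ball z δ ⊆ resolventSet ℂ T ∧
    ∀ V ∈ 𝓝 (0 : X), ∃ U ∈ 𝓝 (0 : X), ∀ μ ∈ Metric.ball z δ, ∀ x ∈ U, resolvent T μ x ∈ V}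

/-- `σ*(T) = ℂ \ ρ*(T)`. -/
def starSpectrum (T : X →L[ℂ] X) : Set ℂ := (starResolventSet T)ᶜ

end StarSpectrum

/-! ### Weighted `c₀` spaces

Sequences are indexed by `ℕ = {0, 1, …}`: the term with index `n` here is the term with
index `n + 1` in the usual numbering from `1`. -/

/-- `c₀(v) = {x : v(n) xₙ → 0}` as a subspace of `ℂ^ℕ`. -/
def weightedC0 (v : ℕ → ℝ) : Submodule ℂ (ℕ → ℂ) where
  carrier := {x | Tendsto (fun n => v n * ‖x n‖) atTop (𝓝 0)}
  zero_mem' := by simp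
  add_mem' := by
    intro x y hx hy
    have hx' : Tendsto (fun n => |v n| * ‖x n‖) atTop (𝓝 0) := by
      simpa [abs_mul] using (show Tendsto _ _ _ from hx).abs
    have hy' : Tendsto (fun n => |v n| * ‖y n‖) atTop (𝓝 0) := by
      simpa [abs_mul] using (show Tendsto _ _ _ from hy).abs
    refine squeeze_zero_norm (fun n => ?_) (by simpa using hx'.add hy')
    simp only [norm_mul, Real.norm_eq_abs, Pi.add_apply, abs_norm]
    rw [← mul_add]
    gcongr
    exact norm_add_le _ _
  smul_mem' := by
    intro c x hx
    have := (show Tendsto _ _ _ from hx).const_mul ‖c‖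
    simp only [mul_zero] at this
    refine this.congr (fun n => ?_)
    simp only [Pi.smul_apply, norm_smul]
    ring

/-- `c₀(v)` as a space of its own, to be given its norm. -/
def WeightedC0 (v : ℕ → ℝ) : Type := weightedC0 v

instance (v : ℕ → ℝ) : AddCommGroup (WeightedC0 v) := inferInstanceAs (AddCommGroup (weightedC0 v))

instance (v : ℕ → ℝ) : Module ℂ (WeightedC0 v) := inferInstanceAs (Module ℂ (weightedC0 v))

lemma weightedC0_bddAbove {v : ℕ → ℝ} (x : WeightedC0 v) :
    BddAbove (range fun n => |v n| * ‖x.1 n‖) := by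
  have h : Tendsto (fun n => |v n| * ‖x.1 n‖) atTop (𝓝 0) := by
    simpa [abs_mul] using (show Tendsto _ _ _ from x.2).abs
  exact h.bddAbove_range

/-- The norm `q(x) = sup_n v(n) |xₙ|` of `c₀(v)`. (The absolute value makes this a seminorm for
every real sequence `v`; it plays no role for positive weights.) -/
def weightedC0Norm (v : ℕ → ℝ) : Seminorm ℂ (WeightedC0 v) :=
  Seminorm.ofSMulLE (fun x => ⨆ n, |v n| * ‖x.1 n‖)
    (by
      have : ∀ n, (0 : WeightedC0 v).1 n = 0 := fun n => rfl
      simp [this])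
    (by
      intro x y
      refine ciSup_le fun n => ?_
      have h1 := le_ciSup (weightedC0_bddAbove x) n
      have h2 := le_ciSup (weightedC0_bddAbove y) n
      calc |v n| * ‖(x + y).1 n‖ ≤ |v n| * (‖x.1 n‖ + ‖y.1 n‖) := by
            gcongr
            exact norm_add_le _ _
        _ = |v n| * ‖x.1 n‖ + |v n| * ‖y.1 n‖ := by ring
        _ ≤ _ := add_le_add h1 h2)
    (by
      intro c x
      refine ciSup_le fun n => ?_
      have h1 := le_ciSup (weightedC0_bddAbove x) n
      have h2 : ‖(c • x).1 n‖ = ‖c‖ * ‖x.1 n‖ := norm_mul _ _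
      calc |v n| * ‖(c • x).1 n‖ = ‖c‖ * (|v n| * ‖x.1 n‖) := by rw [h2]; ring
        _ ≤ _ := by gcongr)

instance (v : ℕ → ℝ) : SeminormedAddCommGroup (WeightedC0 v) :=
  (weightedC0Norm v).toAddGroupSeminorm.toSeminormedAddCommGroup

instance (v : ℕ → ℝ) : NormedSpace ℂ (WeightedC0 v) where
  norm_smul_le c x := le_of_eq (map_smul_eq_mul (weightedC0Norm v) c x)

lemma WeightedC0.norm_def {v : ℕ → ℝ} (x : WeightedC0 v) : ‖x‖ = ⨆ n, |v n| * ‖x.1 n‖ := rfl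

/-! ### The co-echelon space `E_α = ind_k c₀(v_k)` -/

/-- The weights `v_k(n) = s_k ^ (-α_n)`. -/
def coWeight (α s : ℕ → ℝ) (k n : ℕ) : ℝ := s k ^ (-α n)

/-- The vector space `E_α`, the span of the subspaces `c₀(v_k)` of `ℂ^ℕ`. These increase with `k`
if `α` is nonnegative and `s` increasing, and then this is their union
(`mem_coechelonSubmodule`). -/
def coechelonSubmodule (α s : ℕ → ℝ) : Submodule ℂ (ℕ → ℂ) := ⨆ k, weightedC0 (coWeight α s k)

/-- The space `E_α`, to be given its inductive limit topology. -/
def CoechelonSpace (α s : ℕ → ℝ) : Type := coechelonSubmodule α s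

instance (α s : ℕ → ℝ) : AddCommGroup (CoechelonSpace α s) :=
  inferInstanceAs (AddCommGroup (coechelonSubmodule α s))

instance (α s : ℕ → ℝ) : Module ℂ (CoechelonSpace α s) :=
  inferInstanceAs (Module ℂ (coechelonSubmodule α s))

/-- The inclusion `c₀(v_k) → E_α`. -/
def coechelonIncl (α s : ℕ → ℝ) (k : ℕ) : WeightedC0 (coWeight α s k) →ₗ[ℂ] CoechelonSpace α s :=
  Submodule.inclusion (le_iSup (fun k => weightedC0 (coWeight α s k)) k)

/-- The vector space topologies on `E_α` that are locally convex and make all inclusions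
`c₀(v_k) → E_α` continuous. -/
def coechelonTopologies (α s : ℕ → ℝ) : Set (TopologicalSpace (CoechelonSpace α s)) :=
  {t | @IsTopologicalAddGroup _ t _ ∧ @ContinuousSMul ℂ _ _ _ t ∧
    @LocallyConvexSpace ℝ _ _ _ _ _ t ∧ ∀ k, Continuous[_, t] (coechelonIncl α s k)}

/-- The inductive limit topology: the finest of these topologies. (In the order on topologies
the infimum of a set is the coarsest topology finer than all its members; this one belongs to the
set itself, see `coechelonTopology_mem`. For positive weights it is Hausdorff, being finer than the
topology of coordinatewise convergence.) -/
instance coechelonTopology (α s : ℕ → ℝ) : TopologicalSpace (CoechelonSpace α s) :=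
  sInf (coechelonTopologies α s)

lemma coechelonTopology_mem (α s : ℕ → ℝ) : coechelonTopology α s ∈ coechelonTopologies α s :=
  ⟨topologicalAddGroup_sInf fun _ h => h.1, continuousSMul_sInf fun _ h => h.2.1,
    LocallyConvexSpace.sInf fun _ h => h.2.2.1,
    fun k => continuous_sInf_rng.2 fun _ h => h.2.2.2 k⟩

instance (α s : ℕ → ℝ) : IsTopologicalAddGroup (CoechelonSpace α s) :=
  (coechelonTopology_mem α s).1

instance (α s : ℕ → ℝ) : ContinuousSMul ℂ (CoechelonSpace α s) :=
  (coechelonTopology_mem α s).2.1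

instance (α s : ℕ → ℝ) : LocallyConvexSpace ℝ (CoechelonSpace α s) :=
  (coechelonTopology_mem α s).2.2.1

lemma mem_coechelonSubmodule {α s : ℕ → ℝ} (hα : ∀ n, 0 < α n) (hs1 : ∀ k, 1 < s k)
    (hs : StrictMono s) (x : ℕ → ℂ) :
    x ∈ coechelonSubmodule α s ↔ ∃ k, x ∈ weightedC0 (coWeight α s k) := by
  refine Submodule.mem_iSup_of_directed _ (Monotone.directed_le fun k l hkl y hy => ?_)
  refine squeeze_zero (fun n => ?_) (fun n => ?_) hy
  · exact mul_nonneg (Real.rpow_nonneg (by linarith [hs1 l]) _) (norm_nonneg _)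
  · refine mul_le_mul_of_nonneg_right ?_ (norm_nonneg _)
    exact Real.rpow_le_rpow_of_nonpos (by linarith [hs1 k]) (hs.monotone hkl)
      (by linarith [hα n])

/-! ### The Cesàro operator -/

/-- The Cesàro operator on `ℂ^ℕ`: the `n`-th term of `C x` (`n = 0, 1, …`) is the mean of the
first `n + 1` terms of `x`. -/
def cesaroSeq : (ℕ → ℂ) →ₗ[ℂ] (ℕ → ℂ) where
  toFun x n := (∑ i ∈ Finset.range (n + 1), x i) / (n + 1)
  map_add' x y := by
    funext n
    simp [Finset.sum_add_distrib, add_div]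
  map_smul' c x := by
    funext n
    simp [← Finset.mul_sum, mul_div_assoc]

lemma coWeight_pos {α s : ℕ → ℝ} (hs : ∀ k, 1 < s k) (k n : ℕ) : 0 < coWeight α s k n :=
  Real.rpow_pos_of_pos (by linarith [hs k]) _

lemma coWeight_anti {α s : ℕ → ℝ} (hα : StrictMono α) (hs : ∀ k, 1 < s k) (k : ℕ) :
    Antitone (coWeight α s k) := fun _ _ hmn =>
  Real.rpow_le_rpow_of_exponent_le (hs k).le (neg_le_neg (hα.monotone hmn))

lemma cesaroSeq_bound {v : ℕ → ℝ} (hv : ∀ n, 0 < v n) (ha : Antitone v) (x : ℕ → ℂ) (n : ℕ) :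
    v n * ‖cesaroSeq x n‖ ≤ ((n + 1 : ℕ) : ℝ)⁻¹ * ∑ i ∈ Finset.range (n + 1), v i * ‖x i‖ := by
  have h1 : ‖cesaroSeq x n‖ = ((n + 1 : ℕ) : ℝ)⁻¹ * ‖∑ i ∈ Finset.range (n + 1), x i‖ := by
    have : ‖((n : ℂ) + 1)‖ = ((n + 1 : ℕ) : ℝ) := by
      rw [← Nat.cast_succ, Complex.norm_natCast]
    simp only [cesaroSeq, LinearMap.coe_mk, AddHom.coe_mk, norm_div, this]
    rw [div_eq_inv_mul]
  rw [h1, mul_left_comm]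
  gcongr
  calc v n * ‖∑ i ∈ Finset.range (n + 1), x i‖
      ≤ v n * ∑ i ∈ Finset.range (n + 1), ‖x i‖ :=
        mul_le_mul_of_nonneg_left (norm_sum_le _ _) (hv n).le
    _ = ∑ i ∈ Finset.range (n + 1), v n * ‖x i‖ := Finset.mul_sum _ _ _
    _ ≤ _ := Finset.sum_le_sum fun i hi => mul_le_mul_of_nonneg_right
        (ha (Nat.lt_succ_iff.1 (Finset.mem_range.1 hi))) (norm_nonneg _)

lemma cesaroSeq_mem {v : ℕ → ℝ} (hv : ∀ n, 0 < v n) (ha : Antitone v) {x : ℕ → ℂ}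
    (hx : x ∈ weightedC0 v) : cesaroSeq x ∈ weightedC0 v := by
  have h := (tendsto_add_atTop_iff_nat 1).2 (Filter.Tendsto.cesaro (show Tendsto _ _ _ from hx))
  exact squeeze_zero (fun n => mul_nonneg (hv n).le (norm_nonneg _))
    (fun n => cesaroSeq_bound hv ha x n) h

/-- The Cesàro operator on `c₀(v)` for a positive decreasing weight `v`. -/
def cesaroStep {v : ℕ → ℝ} (hv : ∀ n, 0 < v n) (ha : Antitone v) :
    WeightedC0 v →ₗ[ℂ] WeightedC0 v :=
  cesaroSeq.restrict (p := weightedC0 v) (q := weightedC0 v) fun _ hx => cesaroSeq_mem hv ha hx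

lemma cesaroStep_continuous {v : ℕ → ℝ} (hv : ∀ n, 0 < v n) (ha : Antitone v) :
    Continuous (cesaroStep hv ha) := by
  refine AddMonoidHomClass.continuous_of_bound (cesaroStep hv ha) 1 fun x => ?_
  rw [one_mul, WeightedC0.norm_def]
  refine ciSup_le fun n => ?_
  rw [abs_of_pos (hv n)]
  refine (cesaroSeq_bound hv ha x.1 n).trans ?_
  have h : ∀ i ∈ Finset.range (n + 1), v i * ‖x.1 i‖ ≤ ‖x‖ := fun i _ => by
    have := le_ciSup (weightedC0_bddAbove x) i
    rwa [abs_of_pos (hv i)] at this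
  have h' := Finset.sum_le_card_nsmul _ _ _ h
  rw [Finset.card_range, nsmul_eq_mul] at h'
  rw [inv_mul_le_iff₀ (by positivity)]
  exact h'

lemma cesaroSeq_mem_coechelon {α s : ℕ → ℝ} (hα : StrictMono α) (hs : ∀ k, 1 < s k) :
    ∀ x ∈ coechelonSubmodule α s, cesaroSeq x ∈ coechelonSubmodule α s := by
  change coechelonSubmodule α s ≤ (coechelonSubmodule α s).comap cesaroSeq
  exact iSup_le fun k x hx => le_iSup (fun k => weightedC0 (coWeight α s k)) k
    (cesaroSeq_mem (coWeight_pos hs k) (coWeight_anti hα hs k) hx)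

/-- The Cesàro operator `C ∈ L(E_α)`. -/
def cesaro {α s : ℕ → ℝ} (hα : StrictMono α) (hs : ∀ k, 1 < s k) :
    CoechelonSpace α s →L[ℂ] CoechelonSpace α s where
  toLinearMap := cesaroSeq.restrict (p := coechelonSubmodule α s) (q := coechelonSubmodule α s)
    (cesaroSeq_mem_coechelon hα hs)
  cont := by
    set T : CoechelonSpace α s →ₗ[ℂ] CoechelonSpace α s :=
      cesaroSeq.restrict (p := coechelonSubmodule α s) (q := coechelonSubmodule α s)
        (cesaroSeq_mem_coechelon hα hs) with hT
    change Continuous T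
    rw [continuous_iff_le_induced]
    refine sInf_le ⟨topologicalAddGroup_induced T, continuousSMul_induced T,
      LocallyConvexSpace.induced (T.restrictScalars ℝ), fun k => ?_⟩
    rw [continuous_induced_rng]
    exact ((coechelonTopology_mem α s).2.2.2 k).comp
      (cesaroStep_continuous (coWeight_pos hs k) (coWeight_anti hα hs k))

/-- The open disc `D(r) = {z : |z - 1/(2r)| < 1/(2r)}`. -/
def cesaroDisc (r : ℝ) : Set ℂ := {z | ‖z - 1 / (2 * r)‖ < 1 / (2 * r)}

end

open Filter Topology Set

noncomputable section

/-! ### Continuity on the co-echelon space -/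

/-! A sequence lies in `E_α` exactly when it is bounded by a multiple of `exp (A α_n)` for some `A`,
so every question becomes one of comparing growth with `α`. Non-nuclearity is used in one form only:
`log n = O(α_n)` fails, because this estimate would make `E_α` nuclear (`isNuclearSpace_of_log_le`).

Let `μ ≠ 0`, `z = 1/μ` and `g = C w`. The equation `μ w - C w = x` becomes the first-order
recurrence `(n + 2 - z) g_{n+1} = (n + 1) g_n + z x_{n+1}` with `(1 - z) g_0 = z x_0`. Its
homogeneous solutions grow at least like `exp ((Re z - 1) H_n)`, with `H_n ~ log n` the harmonic
numbers (`exists_growth_bound`). Since `μ ∈ D(1)` means `Re z > 1`, there are three regimes.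

If `Re z < 1`, the solution operator maps each step boundedly to itself, locally uniformly in `μ`,
so `μ ∈ ρ*`. If `Re z > 1`, the right-hand side `e_0` produces a homogeneous solution of size at
least `n^(Re z - 1)`; its membership in `E_α` would give `log n = O(α_n)`. If `Re z = 1` and `z ≠
1`, the solution operator loses at most a factor `H_n`, and a resonant right-hand side attains this
loss. A factor `log n` is harmless in `E_α` exactly when `log log n = O(α_n)`, which separates (i)
from (ii).

The points `0` and `1` always lie in the spectrum, by explicit right-hand sides. Finally `σ*` is
closed and contains `σ`, hence contains the closure of `D(1)`; the first regime gives the reverse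
inclusion. -/

lemma WeightedC0.mul_norm_le {v : ℕ → ℝ} (hv : ∀ n, 0 < v n) (x : WeightedC0 v) (n : ℕ) :
    v n * ‖x.1 n‖ ≤ ‖x‖ := by
  have := le_ciSup (weightedC0_bddAbove x) n
  rwa [abs_of_pos (hv n)] at this

lemma WeightedC0.norm_le {v : ℕ → ℝ} (hv : ∀ n, 0 < v n) (x : WeightedC0 v) {M : ℝ}
    (h : ∀ n, v n * ‖x.1 n‖ ≤ M) : ‖x‖ ≤ M := by
  rw [WeightedC0.norm_def]
  refine ciSup_le fun n => ?_
  rw [abs_of_pos (hv n)]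
  exact h n

/-- Local convexity is assumed over `ℝ` while the seminorm must be complex. The convex hull of the
complex balanced core of a convex neighbourhood is again balanced and stays inside it; its gauge is
the seminorm. -/
lemma exists_continuous_seminorm_ball_subset {X : Type*} [AddCommGroup X] [Module ℂ X]
    [TopologicalSpace X] [IsTopologicalAddGroup X] [ContinuousSMul ℂ X] [LocallyConvexSpace ℝ X]
    {V : Set X} (hV : V ∈ 𝓝 0) : ∃ p : Seminorm ℂ X, Continuous p ∧ p.ball 0 1 ⊆ V := by
  have : ContinuousSMul ℝ X := IsScalarTower.continuousSMul ℂ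
  obtain ⟨W, ⟨hW, hWc⟩, hWV⟩ := (LocallyConvexSpace.convex_basis_zero ℝ X).mem_iff.1 hV
  have hB : balancedCore ℂ W ∈ 𝓝 (0 : X) := balancedCore_mem_nhds_zero hW
  set K := convexHull ℝ (balancedCore ℂ W) with hK
  have hK0 : K ∈ 𝓝 (0 : X) := mem_of_superset hB (subset_convexHull ℝ _)
  have hKc : Convex ℝ K := convex_convexHull ℝ _
  have hKb : Balanced ℂ K := by
    refine balanced_iff_smul_mem.2 fun a ha x hx => ?_
    have hsub : K ⊆ (fun y : X => a • y) ⁻¹' K :=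
      convexHull_min (fun y hy => subset_convexHull ℝ _
        ((balancedCore_balanced (𝕜 := ℂ) W).smul_mem ha hy))
        (hKc.is_linear_preimage ⟨fun y z => smul_add a y z, fun c y => smul_comm a c y⟩)
    exact hsub hx
  have hKW : K ⊆ W := convexHull_min (balancedCore_subset W) hWc
  refine ⟨gaugeSeminorm hKb hKc (absorbent_nhds_zero hK0), continuous_gauge hKc hK0, ?_⟩
  intro x hx
  rw [Seminorm.mem_ball_zero] at hx
  exact hWV (hKW (setOfPred_gauge_lt_one_subset_self hKc (mem_of_mem_nhds hK0)
    (absorbent_nhds_zero hK0) hx))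

variable {α s : ℕ → ℝ}

/-- A seminorm on `E_α` is continuous if it is bounded on every step. -/
lemma CoechelonSpace.continuous_seminorm (q : Seminorm ℂ (CoechelonSpace α s))
    (h : ∀ k, ∃ M, ∀ x, q (coechelonIncl α s k x) ≤ M * ‖x‖) : Continuous q := by
  -- The topology of the single seminorm `q` is one of the competing topologies, so the inductive
  -- limit topology is finer.
  let t : TopologicalSpace (CoechelonSpace α s) :=
    (inferInstance : TopologicalSpace (SeminormSpace q))
  have ht : t ∈ coechelonTopologies α s := by
    refine ⟨inferInstanceAs (IsTopologicalAddGroup (SeminormSpace q)),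
      inferInstanceAs (ContinuousSMul ℂ (SeminormSpace q)),
      inferInstanceAs (LocallyConvexSpace ℝ (SeminormSpace q)), fun k => ?_⟩
    obtain ⟨M, hM⟩ := h k
    let f : WeightedC0 (coWeight α s k) →ₗ[ℂ] SeminormSpace q := coechelonIncl α s k
    exact AddMonoidHomClass.continuous_of_bound f M hM
  have hle : coechelonTopology α s ≤ t := sInf_le ht
  have hc : Continuous[t, _] q := (continuous_norm : Continuous (fun x : SeminormSpace q => ‖x‖))
  exact continuous_le_dom hle hc

/-- A continuous seminorm on `E_α` is bounded on every step. -/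
lemma CoechelonSpace.bound_of_continuous (p : Seminorm ℂ (CoechelonSpace α s))
    (hp : Continuous p) (k : ℕ) : ∃ M, 0 < M ∧ ∀ x, p (coechelonIncl α s k x) ≤ M * ‖x‖ :=
  Seminorm.bound_of_continuous_normedSpace (p.comp (coechelonIncl α s k))
    (hp.comp ((coechelonTopology_mem α s).2.2.2 k))

/-- A factor `exp (c α_n)` is absorbed by passing to a later step; this is how every loss in an
estimate is paid for. -/
lemma coWeight_mul_le {α s : ℕ → ℝ} (hα : ∀ n, 0 < α n) (hs1 : ∀ k, 1 < s k) {k l : ℕ} {c : ℝ}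
    (h : s k * Real.exp c ≤ s l) (n : ℕ) :
    coWeight α s l n * Real.exp (c * α n) ≤ coWeight α s k n := by
  have hk : 0 < s k := by linarith [hs1 k]
  have hl : 0 < s l := by linarith [hs1 l]
  have h' : Real.log (s k) + c ≤ Real.log (s l) := by
    rw [← Real.log_exp c, ← Real.log_mul hk.ne' (Real.exp_pos c).ne']
    exact Real.log_le_log (by positivity) h
  rw [coWeight, coWeight, Real.rpow_def_of_pos hk, Real.rpow_def_of_pos hl, ← Real.exp_add]
  refine Real.exp_le_exp.2 ?_
  nlinarith [hα n]

lemma exists_mul_exp_le (hs_lim : Tendsto s atTop atTop) (k : ℕ) (c : ℝ) :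
    ∃ l, s k * Real.exp c ≤ s l :=
  (hs_lim.eventually_ge_atTop _).exists

/-- The quotient `v_{k+1}(n) / v_k(n) = (s_k / s_{k+1})^{α_n}` tends to `0`. Hence plain sup bounds
suffice throughout, and null sequences need not be tracked. -/
lemma mem_weightedC0_succ (hα_lim : Tendsto α atTop atTop) (hs1 : ∀ k, 1 < s k)
    (hs : StrictMono s) {k : ℕ} {M : ℝ} {x : ℕ → ℂ} (h : ∀ n, coWeight α s k n * ‖x n‖ ≤ M) :
    x ∈ weightedC0 (coWeight α s (k + 1)) := by
  have hk : 0 < s k := by linarith [hs1 k]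
  have hl : 0 < s (k + 1) := by linarith [hs1 (k + 1)]
  have hlog : Real.log (s k) < Real.log (s (k + 1)) := Real.log_lt_log hk (hs k.lt_succ_self)
  have hfac : ∀ n, coWeight α s (k + 1) n
      = Real.exp ((Real.log (s k) - Real.log (s (k + 1))) * α n) * coWeight α s k n := fun n => by
    rw [coWeight, coWeight, Real.rpow_def_of_pos hk, Real.rpow_def_of_pos hl, ← Real.exp_add]
    ring_nf
  have h0 : Tendsto (fun n => Real.exp ((Real.log (s k) - Real.log (s (k + 1))) * α n) * M)
      atTop (𝓝 0) := by
    have := Real.tendsto_exp_atBot.comp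
      (hα_lim.const_mul_atTop_of_neg (sub_neg.2 hlog))
    simpa using this.mul_const M
  refine squeeze_zero (fun n => mul_nonneg (coWeight_pos hs1 _ n).le (norm_nonneg _))
    (fun n => ?_) h0
  rw [hfac, mul_assoc]
  exact mul_le_mul_of_nonneg_left (h n) (Real.exp_pos _).le

lemma coWeight_succ_le (hα : ∀ n, 0 < α n) (hs1 : ∀ k, 1 < s k) (hs : StrictMono s) (k n : ℕ) :
    coWeight α s (k + 1) n ≤ coWeight α s k n :=
  Real.rpow_le_rpow_of_nonpos (by linarith [hs1 k]) (hs k.lt_succ_self).le (by linarith [hα n])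

lemma mem_coechelonSubmodule_of_bound (hα_lim : Tendsto α atTop atTop) (hs1 : ∀ k, 1 < s k)
    (hs : StrictMono s) {k : ℕ} {M : ℝ} {x : ℕ → ℂ} (h : ∀ n, coWeight α s k n * ‖x n‖ ≤ M) :
    x ∈ coechelonSubmodule α s :=
  le_iSup (fun k => weightedC0 (coWeight α s k)) (k + 1) (mem_weightedC0_succ hα_lim hs1 hs h)

lemma exists_bound_of_mem (hα : ∀ n, 0 < α n) (hs1 : ∀ k, 1 < s k)
    (hs : StrictMono s) {x : ℕ → ℂ} (hx : x ∈ coechelonSubmodule α s) :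
    ∃ k M, ∀ n, coWeight α s k n * ‖x n‖ ≤ M := by
  obtain ⟨k, hk⟩ := (mem_coechelonSubmodule hα hs1 hs x).1 hx
  exact ⟨k, _, WeightedC0.mul_norm_le (coWeight_pos hs1 k) (⟨x, hk⟩ : weightedC0 _)⟩

/-- A family of linear maps of `ℂ^ℕ` that is uniformly bounded from each weighted sup-norm
`v_k` to some weighted sup-norm `v_l`. -/
def UniformlyStepBounded (α s : ℕ → ℝ) {ι : Type*} (T : ι → (ℕ → ℂ) →ₗ[ℂ] (ℕ → ℂ)) : Prop :=
  ∀ k, ∃ l M, ∀ i x N, (∀ n, coWeight α s k n * ‖x n‖ ≤ N) →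
    ∀ n, coWeight α s l n * ‖T i x n‖ ≤ M * N

lemma UniformlyStepBounded.mem {ι : Type*} {T : ι → (ℕ → ℂ) →ₗ[ℂ] (ℕ → ℂ)}
    (hT : UniformlyStepBounded α s T) (hα : ∀ n, 0 < α n) (hα_lim : Tendsto α atTop atTop)
    (hs1 : ∀ k, 1 < s k) (hs : StrictMono s) (i : ι) :
    ∀ x ∈ coechelonSubmodule α s, T i x ∈ coechelonSubmodule α s := by
  intro x hx
  obtain ⟨k, N, hN⟩ := exists_bound_of_mem hα hs1 hs hx
  obtain ⟨l, M, h⟩ := hT k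
  exact mem_coechelonSubmodule_of_bound hα_lim hs1 hs (h i x N hN)

/-- A uniformly step-bounded family is equicontinuous on `E_α`. -/
lemma UniformlyStepBounded.equicontinuous {ι : Type*} {T : ι → (ℕ → ℂ) →ₗ[ℂ] (ℕ → ℂ)}
    (hT : UniformlyStepBounded α s T) (hα : ∀ n, 0 < α n) (hα_lim : Tendsto α atTop atTop)
    (hs1 : ∀ k, 1 < s k) (hs : StrictMono s)
    (S : ι → CoechelonSpace α s →ₗ[ℂ] CoechelonSpace α s) (hS : ∀ i x, (S i x).1 = T i x.1) :
    ∀ V ∈ 𝓝 (0 : CoechelonSpace α s), ∃ U ∈ 𝓝 (0 : CoechelonSpace α s),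
      ∀ i, ∀ x ∈ U, S i x ∈ V := by
  intro V hV
  rcases isEmpty_or_nonempty ι with hι | hι
  · exact ⟨univ, univ_mem, fun i => hι.elim i⟩
  obtain ⟨p, hpc, hVr⟩ := exists_continuous_seminorm_ball_subset hV
  have hbound : ∀ k, ∃ M, ∀ i (x : WeightedC0 (coWeight α s k)),
      p (S i (coechelonIncl α s k x)) ≤ M * ‖x‖ := by
    intro k
    obtain ⟨l, M, h⟩ := hT k
    obtain ⟨M', hM', hp'⟩ := CoechelonSpace.bound_of_continuous p hpc (l + 1)
    refine ⟨M' * M, fun i x => ?_⟩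
    have hx := h i x.1 ‖x‖ (WeightedC0.mul_norm_le (coWeight_pos hs1 k) x)
    let y : WeightedC0 (coWeight α s (l + 1)) :=
      (⟨T i x.1, mem_weightedC0_succ hα_lim hs1 hs hx⟩ : weightedC0 _)
    have hy : S i (coechelonIncl α s k x) = coechelonIncl α s (l + 1) y :=
      Subtype.ext (hS i _)
    rw [hy, mul_assoc]
    refine (hp' y).trans (mul_le_mul_of_nonneg_left ?_ hM'.le)
    refine WeightedC0.norm_le (coWeight_pos hs1 _) y fun n => ?_
    refine le_trans ?_ (hx n)
    exact mul_le_mul_of_nonneg_right (coWeight_succ_le hα hs1 hs l n) (norm_nonneg _)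
  have hbdd : ∀ x, BddAbove (range fun i => p (S i x)) := by
    intro x
    obtain ⟨k, hk⟩ := (mem_coechelonSubmodule hα hs1 hs x.1).1 x.2
    obtain ⟨M, h⟩ := hbound k
    refine ⟨M * ‖(show WeightedC0 (coWeight α s k) from (⟨x.1, hk⟩ : weightedC0 _))‖, ?_⟩
    rintro _ ⟨i, rfl⟩
    exact h i (show WeightedC0 (coWeight α s k) from (⟨x.1, hk⟩ : weightedC0 _))
  -- The supremum of the seminorms `p ∘ S i` is finite and bounded on every step, hence continuous;
  -- its unit ball is the common neighbourhood.
  let q : Seminorm ℂ (CoechelonSpace α s) :=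
    Seminorm.ofSMulLE (fun x => ⨆ i, p (S i x)) (by simp)
      (fun x y => ciSup_le fun i => by
        rw [map_add]
        exact (map_add_le_add p _ _).trans (add_le_add (le_ciSup (hbdd x) i) (le_ciSup (hbdd y) i)))
      (fun c x => ciSup_le fun i => by
        rw [map_smul, map_smul_eq_mul]
        exact mul_le_mul_of_nonneg_left (le_ciSup (hbdd x) i) (norm_nonneg c))
  have hqc : Continuous q := by
    refine CoechelonSpace.continuous_seminorm q fun k => ?_
    obtain ⟨M, h⟩ := hbound k
    exact ⟨M, fun x => ciSup_le fun i => h i x⟩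
  refine ⟨q.ball 0 1, q.ball_mem_nhds hqc one_pos, fun i x hx => hVr ?_⟩
  rw [Seminorm.mem_ball_zero] at hx ⊢
  exact (le_ciSup (hbdd x) i).trans_lt hx

/-- The operator on `E_α` induced by a step-bounded linear map of `ℂ^ℕ`. -/
lemma UniformlyStepBounded.exists_clm {T : (ℕ → ℂ) →ₗ[ℂ] (ℕ → ℂ)}
    (hT : UniformlyStepBounded α s (fun _ : Unit => T)) (hα : ∀ n, 0 < α n)
    (hα_lim : Tendsto α atTop atTop) (hs1 : ∀ k, 1 < s k) (hs : StrictMono s) :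
    ∃ S : CoechelonSpace α s →L[ℂ] CoechelonSpace α s, ∀ x, (S x).1 = T x.1 := by
  let S : CoechelonSpace α s →ₗ[ℂ] CoechelonSpace α s :=
    T.restrict (p := coechelonSubmodule α s) (q := coechelonSubmodule α s)
      (hT.mem hα hα_lim hs1 hs ())
  have hS : ∀ x, (S x).1 = T x.1 := fun x => rfl
  refine ⟨⟨S, ?_⟩, hS⟩
  refine continuous_of_continuousAt_zero S.toAddMonoidHom ?_
  intro V hV
  have hV' : V ∈ 𝓝 (0 : CoechelonSpace α s) := by simpa using hV
  obtain ⟨U, hU, h⟩ := hT.equicontinuous hα hα_lim hs1 hs (fun _ => S) (fun _ => hS) V hV'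
  exact mem_map.2 (mem_of_superset hU fun x hx => h () x hx)

/-! ### A criterion for nuclearity -/

lemma ContinuousLinearMap.exists_completion_extension {X : Type*} [SeminormedAddCommGroup X]
    [NormedSpace ℂ X] (f : X →ₗ[ℂ] ℂ) {C : ℝ} (hC : 0 ≤ C) (hf : ∀ x, ‖f x‖ ≤ C * ‖x‖) :
    ∃ F : UniformSpace.Completion X →L[ℂ] ℂ, ‖F‖ ≤ C ∧ ∀ x : X, F x = f x := by
  let g : X →L[ℂ] ℂ := f.mkContinuous C hf
  let e : X →L[ℂ] UniformSpace.Completion X := UniformSpace.Completion.toComplL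
  have hd : DenseRange e := UniformSpace.Completion.denseRange_coe
  have hu : IsUniformInducing e := UniformSpace.Completion.isUniformInducing_coe X
  have hF : ∀ x : X, g.extend e (e x) = f x := fun x => g.extend_eq hd hu x
  refine ⟨g.extend e, ContinuousLinearMap.opNorm_le_bound _ hC fun x => ?_, hF⟩
  refine isClosed_property (p := fun x => ‖g.extend e x‖ ≤ C * ‖x‖) hd
    (isClosed_le (by fun_prop) (by fun_prop)) (fun x => ?_) x
  rw [hF]
  exact (hf x).trans_eq (by rw [show ‖e x‖ = ‖x‖ from UniformSpace.Completion.norm_coe x])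

/-- A map between completions is nuclear if it has an absolutely convergent expansion on the
dense subspace. -/
lemma isNuclearMap_localBanachMap {X : Type*} [AddCommGroup X] [Module ℂ X] {p q : Seminorm ℂ X}
    (h : p ≤ q) (f : ℕ → X →ₗ[ℂ] ℂ) (y : ℕ → X) (C : ℕ → ℝ) (hC : ∀ n, 0 ≤ C n)
    (hf : ∀ n x, ‖f n x‖ ≤ C n * q x) (hsum : Summable fun n => C n * p (y n))
    (hlim : ∀ x, Tendsto (fun N => p (x - ∑ n ∈ Finset.range N, f n x • y n)) atTop (𝓝 0)) :
    IsNuclearMap (localBanachMap h) := by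
  choose F hFC hF using fun n => ContinuousLinearMap.exists_completion_extension
    (X := SeminormSpace q) (f n) (hC n) (hf n)
  let Y : ℕ → LocalBanach p := fun n => ((show SeminormSpace p from y n) : LocalBanach p)
  have hY : ∀ n, ‖Y n‖ = p (y n) := fun n => UniformSpace.Completion.norm_coe _
  have hs : Summable fun n => ‖F n‖ * ‖Y n‖ := by
    refine Summable.of_nonneg_of_le (fun n => by positivity) (fun n => ?_) hsum
    rw [hY]
    exact mul_le_mul_of_nonneg_right (hFC n) (apply_nonneg p _)
  have hs' : Summable fun n => (F n).smulRight (Y n) := by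
    refine Summable.of_norm (hs.congr fun n => ?_)
    rw [ContinuousLinearMap.norm_smulRight_apply]
  have hS : ∀ x, HasSum (fun n => F n x • Y n) ((∑' n, (F n).smulRight (Y n)) x) := fun x => by
    simpa using (ContinuousLinearMap.apply ℂ (LocalBanach p) x).hasSum hs'.hasSum
  -- The series converges in operator norm; on the dense subspace `hlim` identifies its sum, and
  -- continuity does the rest.
  have hST : (∑' n, (F n).smulRight (Y n)) = localBanachMap h := by
    ext x
    refine isClosed_property (UniformSpace.Completion.denseRange_coe (α := SeminormSpace q))
      (isClosed_eq (by fun_prop) (by fun_prop)) (fun x => ?_) x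
    refine tendsto_nhds_unique (hS x).tendsto_sum_nat ?_
    have hT : localBanachMap h (x : LocalBanach q)
        = ((show SeminormSpace p from x) : LocalBanach p) :=
      (seminormSpaceMap h).completion_apply_coe x
    rw [hT, tendsto_iff_norm_sub_tendsto_zero]
    refine (hlim x).congr fun N => ?_
    have hsumN : ∑ n ∈ Finset.range N, F n x • Y n
        = ((show SeminormSpace p from ∑ n ∈ Finset.range N, f n x • y n) : LocalBanach p) := by
      have := map_sum (UniformSpace.Completion.toComplL (𝕜 := ℂ) (E := SeminormSpace p))
        (fun n => f n x • (show SeminormSpace p from y n)) (Finset.range N)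
      refine Eq.trans (Finset.sum_congr rfl fun n _ => ?_) this.symm
      rw [hF, map_smul]
      rfl
    have hnorm : ∀ a b : SeminormSpace p, ‖(a : LocalBanach p) - (b : LocalBanach p)‖ = ‖a - b‖ :=
      fun a b => by rw [← UniformSpace.Completion.coe_sub, UniformSpace.Completion.norm_coe]
    rw [hsumN]
    exact (map_sub_rev p _ _).trans (hnorm _ _).symm
  exact ⟨F, Y, hs, fun x => hST ▸ hS x⟩

/-- The unit vectors of `E_α`. -/
def coechelonUnit (α s : ℕ → ℝ) (n : ℕ) : CoechelonSpace α s :=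
  (⟨Pi.single n 1, le_iSup (fun k => weightedC0 (coWeight α s k)) 0 (by
    refine tendsto_const_nhds.congr' ?_
    filter_upwards [eventually_gt_atTop n] with m hm
    simp [Pi.single_eq_of_ne hm.ne'])⟩ : coechelonSubmodule α s)

/-- The coordinate functionals of `E_α`. -/
def coechelonCoord (α s : ℕ → ℝ) (n : ℕ) : CoechelonSpace α s →ₗ[ℂ] ℂ where
  toFun x := x.1 n
  map_add' _ _ := rfl
  map_smul' _ _ := rfl

lemma sum_smul_coechelonUnit_apply (c : ℕ → ℂ) (N n : ℕ) :
    (∑ m ∈ Finset.range N, c m • coechelonUnit α s m).1 n = if n < N then c n else 0 := by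
  have : (∑ m ∈ Finset.range N, c m • coechelonUnit α s m).1
      = ∑ m ∈ Finset.range N, c m • (Pi.single m 1 : ℕ → ℂ) :=
    map_sum (coechelonSubmodule α s).subtype (fun m => c m • coechelonUnit α s m) _
  rw [this, Finset.sum_apply]
  simp [Pi.single_apply]

/-- The finite sections of `x ∈ E_α` converge to `x`. -/
lemma tendsto_seminorm_sub_sections (hα : ∀ n, 0 < α n) (hs1 : ∀ k, 1 < s k) (hs : StrictMono s)
    {p : Seminorm ℂ (CoechelonSpace α s)} (hp : Continuous p) (x : CoechelonSpace α s) :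
    Tendsto (fun N => p (x - ∑ n ∈ Finset.range N, x.1 n • coechelonUnit α s n)) atTop (𝓝 0) := by
  obtain ⟨k, hk⟩ := (mem_coechelonSubmodule hα hs1 hs x.1).1 x.2
  obtain ⟨M, hM, hpM⟩ := CoechelonSpace.bound_of_continuous p hp k
  rw [Metric.tendsto_atTop]
  intro ε hε
  have hk' : Tendsto (fun n => coWeight α s k n * ‖x.1 n‖) atTop (𝓝 0) := hk
  -- The factor 2 restores the strict inequality lost in taking a supremum over the tail.
  obtain ⟨N₀, hN₀⟩ := eventually_atTop.1 (hk'.eventually_lt_const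
    (show (0 : ℝ) < ε / (2 * M) by positivity))
  refine ⟨N₀, fun N hN => ?_⟩
  set d := x - ∑ n ∈ Finset.range N, x.1 n • coechelonUnit α s n with hd
  have hdn : ∀ n, d.1 n = if n < N then 0 else x.1 n := fun n => by
    have : d.1 n = x.1 n - (∑ m ∈ Finset.range N, x.1 m • coechelonUnit α s m).1 n := rfl
    rw [this, sum_smul_coechelonUnit_apply]
    split_ifs <;> simp
  have hdle : ∀ n, coWeight α s k n * ‖d.1 n‖ ≤ ε / (2 * M) := fun n => by
    rw [hdn]
    split_ifs with h
    · simp only [norm_zero, mul_zero]; positivity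
    · exact (hN₀ n (by omega)).le
  have hdk : d.1 ∈ weightedC0 (coWeight α s k) := by
    refine hk'.congr' ?_
    filter_upwards [eventually_ge_atTop N] with n hn
    rw [hdn, if_neg (by omega)]
  let d' : WeightedC0 (coWeight α s k) := (⟨d.1, hdk⟩ : weightedC0 _)
  have h1 : p d ≤ M * ‖d'‖ := hpM d'
  have h2 : ‖d'‖ ≤ ε / (2 * M) := WeightedC0.norm_le (coWeight_pos hs1 k) d' hdle
  rw [Real.dist_eq, sub_zero, abs_of_nonneg (apply_nonneg p _)]
  calc p d ≤ M * (ε / (2 * M)) := h1.trans (mul_le_mul_of_nonneg_left h2 hM.le)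
    _ = ε / 2 := by field_simp
    _ < ε := half_lt_self hε

/-- `E_α` is nuclear if `log n = O(α_n)`. -/
lemma isNuclearSpace_of_log_le (hα : ∀ n, 0 < α n) (hs1 : ∀ k, 1 < s k) (hs : StrictMono s)
    (hs_lim : Tendsto s atTop atTop) {A : ℝ} (hA : ∀ n : ℕ, Real.log ((n : ℝ) + 1) ≤ A * α n) :
    IsNuclearSpace (CoechelonSpace α s) := by
  intro p hp
  set c : ℕ → ℝ := fun n => p (coechelonUnit α s n) with hc
  have hc0 : ∀ n, 0 ≤ c n := fun n => apply_nonneg p _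
  have hck : ∀ k, ∃ M, 0 < M ∧ ∀ n, c n ≤ M * coWeight α s k n := by
    intro k
    obtain ⟨M, hM, h⟩ := CoechelonSpace.bound_of_continuous p hp k
    refine ⟨M, hM, fun n => ?_⟩
    let u : WeightedC0 (coWeight α s k) := (⟨Pi.single n 1, by
      refine tendsto_const_nhds.congr' ?_
      filter_upwards [eventually_gt_atTop n] with m hm
      simp [Pi.single_eq_of_ne hm.ne']⟩ : weightedC0 _)
    have hu : ‖u‖ ≤ coWeight α s k n := by
      refine WeightedC0.norm_le (coWeight_pos hs1 k) u fun m => ?_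
      change coWeight α s k m * ‖(Pi.single n 1 : ℕ → ℂ) m‖ ≤ _
      rcases eq_or_ne m n with rfl | hmn
      · simp
      · simpa [Pi.single_eq_of_ne hmn] using (coWeight_pos hs1 k n).le
    exact (h u).trans (mul_le_mul_of_nonneg_left hu hM.le)
  -- By hypothesis `(n + 1)^4 ≤ exp (4 A α_n)`, which a later step absorbs. Two of these powers
  -- serve as the weight in `q` below, the other two make the series converge.
  have hterm : ∀ m, ∃ M, ∀ (x : ℕ → ℂ) (N : ℝ), (∀ n, coWeight α s m n * ‖x n‖ ≤ N) →
      ∀ n : ℕ, ((n : ℝ) + 1) ^ 2 * c n * ‖x n‖ ≤ M * N * (1 / ((n : ℝ) + 1) ^ 2) := by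
    intro m
    obtain ⟨k, hk⟩ := exists_mul_exp_le hs_lim m (4 * A)
    obtain ⟨M, hM, hcM⟩ := hck k
    refine ⟨M, fun x N hN n => ?_⟩
    have hn : (0 : ℝ) < (n : ℝ) + 1 := by positivity
    have h4 : ((n : ℝ) + 1) ^ 4 ≤ Real.exp (4 * A * α n) := by
      calc ((n : ℝ) + 1) ^ 4 = Real.exp (4 * Real.log ((n : ℝ) + 1)) := by
            rw [show (4 : ℝ) = ((4 : ℕ) : ℝ) by norm_num, Real.exp_nat_mul, Real.exp_log hn]
        _ ≤ _ := Real.exp_le_exp.2 (by linarith [hA n])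
    have hw : coWeight α s k n * ((n : ℝ) + 1) ^ 4 ≤ coWeight α s m n :=
      (mul_le_mul_of_nonneg_left h4 (coWeight_pos hs1 k n).le).trans
        (coWeight_mul_le hα hs1 hk n)
    rw [mul_one_div, le_div_iff₀ (by positivity)]
    calc ((n : ℝ) + 1) ^ 2 * c n * ‖x n‖ * ((n : ℝ) + 1) ^ 2
        = c n * (((n : ℝ) + 1) ^ 4 * ‖x n‖) := by ring
      _ ≤ M * coWeight α s k n * (((n : ℝ) + 1) ^ 4 * ‖x n‖) :=
          mul_le_mul_of_nonneg_right (hcM n) (by positivity)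
      _ = M * ((coWeight α s k n * ((n : ℝ) + 1) ^ 4) * ‖x n‖) := by ring
      _ ≤ M * (coWeight α s m n * ‖x n‖) := by gcongr
      _ ≤ M * N := by gcongr; exact hN n
  have hsq : Summable fun n : ℕ => 1 / ((n : ℝ) + 1) ^ 2 := by
    have := (summable_nat_add_iff 1).2 (Real.summable_one_div_nat_pow.2 one_lt_two)
    simpa using this
  have hsummable : ∀ x : CoechelonSpace α s,
      Summable fun n : ℕ => ((n : ℝ) + 1) ^ 2 * c n * ‖x.1 n‖ := by
    intro x
    obtain ⟨m, N, hN⟩ := exists_bound_of_mem hα hs1 hs x.2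
    obtain ⟨M, hM⟩ := hterm m
    exact Summable.of_nonneg_of_le (fun n => by have := hc0 n; positivity) (hM x.1 N hN)
      (hsq.mul_left _)
  -- With respect to `q` the `n`-th coordinate has norm at most `1 / ((n + 1)^2 c n)` when `c n ≠
  -- 0`. Since `p (e_n) = c n`, the unit vector expansion has terms of size at most `1 / (n + 1)^2`.
  let q : Seminorm ℂ (CoechelonSpace α s) :=
    Seminorm.ofSMulLE (fun x => ∑' n : ℕ, ((n : ℝ) + 1) ^ 2 * c n * ‖x.1 n‖)
      (by
        have : ∀ n, (0 : CoechelonSpace α s).1 n = 0 := fun n => rfl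
        simp [this])
      (fun x y => by
        rw [← (hsummable x).tsum_add (hsummable y)]
        refine (hsummable (x + y)).tsum_le_tsum (fun n => ?_) ((hsummable x).add (hsummable y))
        rw [← mul_add]
        exact mul_le_mul_of_nonneg_left (norm_add_le (x.1 n) (y.1 n))
          (by have := hc0 n; positivity))
      (fun a x => by
        rw [← tsum_mul_left]
        refine (hsummable (a • x)).tsum_le_tsum (fun n => ?_) ((hsummable x).mul_left _)
        have : ‖(a • x).1 n‖ = ‖a‖ * ‖x.1 n‖ := norm_mul _ _
        rw [this]
        exact le_of_eq (by ring))
  have hq : ∀ x (n : ℕ), ((n : ℝ) + 1) ^ 2 * c n * ‖x.1 n‖ ≤ q x := fun x n =>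
    (hsummable x).le_tsum n fun j _ => by have := hc0 j; positivity
  have hqc : Continuous q := by
    refine CoechelonSpace.continuous_seminorm q fun m => ?_
    obtain ⟨M, hM⟩ := hterm m
    refine ⟨M * ∑' n : ℕ, 1 / ((n : ℝ) + 1) ^ 2, fun x => ?_⟩
    have hx := hM x.1 ‖x‖ (WeightedC0.mul_norm_le (coWeight_pos hs1 m) x)
    have := (hsummable (coechelonIncl α s m x)).tsum_le_tsum hx (hsq.mul_left _)
    rw [tsum_mul_left] at this
    exact this.trans_eq (by ring)
  have hlim := tendsto_seminorm_sub_sections hα hs1 hs hp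
  have hpq : p ≤ q := by
    intro x
    refine ge_of_tendsto (x := atTop) (f := fun N : ℕ =>
      p (x - ∑ n ∈ Finset.range N, x.1 n • coechelonUnit α s n) + q x)
      (by simpa using (hlim x).add_const (q x)) (Eventually.of_forall fun N => ?_)
    have h1 : p x ≤ p (x - ∑ n ∈ Finset.range N, x.1 n • coechelonUnit α s n)
        + p (∑ n ∈ Finset.range N, x.1 n • coechelonUnit α s n) := by
      simpa using map_add_le_add p (x - ∑ n ∈ Finset.range N, x.1 n • coechelonUnit α s n)
        (∑ n ∈ Finset.range N, x.1 n • coechelonUnit α s n)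
    refine h1.trans (add_le_add le_rfl ?_)
    calc p (∑ n ∈ Finset.range N, x.1 n • coechelonUnit α s n)
        ≤ ∑ n ∈ Finset.range N, p (x.1 n • coechelonUnit α s n) := Finset.le_sum_of_subadditive p (map_zero p).le (map_add_le_add p) _ _
      _ ≤ ∑ n ∈ Finset.range N, ((n : ℝ) + 1) ^ 2 * c n * ‖x.1 n‖ := by
          refine Finset.sum_le_sum fun n _ => ?_
          rw [map_smul_eq_mul]
          have h1 : (1 : ℝ) ≤ ((n : ℝ) + 1) ^ 2 := one_le_pow₀ (by linarith [n.cast_nonneg (α := ℝ)])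
          have := mul_le_mul_of_nonneg_right h1 (mul_nonneg (hc0 n) (norm_nonneg (x.1 n)))
          linarith [mul_comm (c n) ‖x.1 n‖]
      _ ≤ q x := (hsummable x).sum_le_tsum _ fun j _ => by have := hc0 j; positivity
  -- Where `c n = 0` the term of index `n` in `q` gives no control of the coordinate; it is dropped,
  -- which `p` does not notice.
  let f : ℕ → CoechelonSpace α s →ₗ[ℂ] ℂ := fun n =>
    if c n = 0 then 0 else coechelonCoord α s n
  have hfz : ∀ n x, c n = 0 → f n x = 0 := fun n x h => by simp [f, h]
  have hfn : ∀ n x, c n ≠ 0 → f n x = x.1 n := fun n x h => by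
    simp only [f, if_neg h]; rfl
  refine ⟨q, hpq, hqc, isNuclearMap_localBanachMap hpq f (coechelonUnit α s)
    (fun n => 1 / (((n : ℝ) + 1) ^ 2 * c n)) (fun n => by have := hc0 n; positivity) ?_ ?_ ?_⟩
  · intro n x
    by_cases h : c n = 0
    · simp [hfz n x h, h]
    · have hpos : 0 < c n := lt_of_le_of_ne (hc0 n) (Ne.symm h)
      rw [hfn n x h, one_div_mul_eq_div, le_div_iff₀ (by positivity)]
      linarith [hq x n]
  · refine Summable.of_nonneg_of_le (fun n => ?_) (fun n => ?_) hsq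
    · have := hc0 n
      exact mul_nonneg (by positivity) (hc0 n)
    · change 1 / (((n : ℝ) + 1) ^ 2 * c n) * c n ≤ _
      by_cases h : c n = 0
      · simp only [h, mul_zero]; positivity
      · exact le_of_eq (by field_simp)
  · intro x
    refine squeeze_zero (fun N => apply_nonneg p _) (fun N => ?_) (hlim x)
    have hz : p (∑ n ∈ Finset.range N, (x.1 n - f n x) • coechelonUnit α s n) ≤ 0 := by
      refine (Finset.le_sum_of_subadditive p (map_zero p).le (map_add_le_add p) _ _).trans (Finset.sum_nonpos fun n _ => ?_)
      rw [map_smul_eq_mul]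
      by_cases h : c n = 0
      · exact (mul_eq_zero_of_right _ h).le
      · simp [hfn n x h]
    have hsplit : x - ∑ n ∈ Finset.range N, f n x • coechelonUnit α s n
        = (x - ∑ n ∈ Finset.range N, x.1 n • coechelonUnit α s n)
          + ∑ n ∈ Finset.range N, (x.1 n - f n x) • coechelonUnit α s n := by
      simp only [sub_smul, Finset.sum_sub_distrib]
      abel
    rw [hsplit]
    linarith [map_add_le_add p (x - ∑ n ∈ Finset.range N, x.1 n • coechelonUnit α s n)
      (∑ n ∈ Finset.range N, (x.1 n - f n x) • coechelonUnit α s n)]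

/-! ### Solving `λ w - C w = x` in `ℂ^ℕ` -/

lemma cesaroSeq_zero_apply (w : ℕ → ℂ) : cesaroSeq w 0 = w 0 := by
  simp [cesaroSeq]

lemma natCast_add_two_ne_zero (n : ℕ) : (n : ℂ) + 2 ≠ 0 := by
  exact_mod_cast (Nat.succ_ne_zero (n + 1))

lemma cesaroSeq_succ_apply (w : ℕ → ℂ) (n : ℕ) :
    ((n : ℂ) + 2) * cesaroSeq w (n + 1) = ((n : ℂ) + 1) * cesaroSeq w n + w (n + 1) := by
  have h1 : (n : ℂ) + 1 ≠ 0 := n.cast_add_one_ne_zero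
  have h2 : (n : ℂ) + 1 + 1 ≠ 0 := by
    rw [add_assoc, one_add_one_eq_two]; exact natCast_add_two_ne_zero n
  have h3 : (n : ℂ) + 2 = n + 1 + 1 := by ring
  simp only [cesaroSeq, LinearMap.coe_mk, AddHom.coe_mk]
  rw [Finset.sum_range_succ _ (n + 1), mul_div_cancel₀ _ h1, h3]
  push_cast
  rw [mul_div_cancel₀ _ h2]

/-- Used to recognise the auxiliary sequence `g` as the sequence of means of the candidate solution.
-/
lemma cesaroSeq_eq_of_recurrence {w g : ℕ → ℂ} (h0 : g 0 = w 0)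
    (hg : ∀ n : ℕ, ((n : ℂ) + 2) * g (n + 1) = ((n : ℂ) + 1) * g n + w (n + 1)) :
    cesaroSeq w = g := by
  funext n
  induction n with
  | zero => rw [cesaroSeq_zero_apply, h0]
  | succ n ih =>
    refine mul_left_cancel₀ (natCast_add_two_ne_zero n) ?_
    rw [cesaroSeq_succ_apply, hg, ih]

/-- The recurrence for `g = C w` when `z⁻¹ w - C w = x`. -/
lemma cesaroSeq_of_equation {z : ℂ} (hz : z ≠ 0) {w x : ℕ → ℂ}
    (h : z⁻¹ • w - cesaroSeq w = x) :
    (1 - z) * cesaroSeq w 0 = z * x 0 ∧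
      (∀ n : ℕ, ((n : ℂ) + 2 - z) * cesaroSeq w (n + 1)
        = ((n : ℂ) + 1) * cesaroSeq w n + z * x (n + 1)) ∧
      w = z • (x + cesaroSeq w) := by
  have hw : ∀ n, w n = z * (x n + cesaroSeq w n) := fun n => by
    rw [← h]
    simp [hz]
  refine ⟨?_, fun n => ?_, funext hw⟩
  · have := hw 0
    rw [← cesaroSeq_zero_apply w] at this
    linear_combination this
  · have := cesaroSeq_succ_apply w n
    linear_combination this + hw (n + 1)

/-- The solution `g` of the recurrence `(n + 1 - z) g_n = n g_{n-1} + z x_n`. -/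
def cesaroSolveAux (z : ℂ) (x : ℕ → ℂ) : ℕ → ℂ
  | 0 => z * x 0 / (1 - z)
  | n + 1 => (((n : ℂ) + 1) * cesaroSolveAux z x n + z * x (n + 1)) / ((n : ℂ) + 2 - z)

/-- The inverse of `z⁻¹ - C` on `ℂ^ℕ`. -/
def cesaroSolve (z : ℂ) : (ℕ → ℂ) →ₗ[ℂ] (ℕ → ℂ) where
  toFun x := z • (x + cesaroSolveAux z x)
  map_add' x y := by
    have : cesaroSolveAux z (x + y) = cesaroSolveAux z x + cesaroSolveAux z y := by
      funext n
      induction n with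
      | zero => simp only [cesaroSolveAux, Pi.add_apply]; ring
      | succ n ih =>
        rw [Pi.add_apply] at ih
        simp only [cesaroSolveAux, Pi.add_apply, ih]
        ring
    rw [this, ← smul_add]
    congr 1
    abel
  map_smul' c x := by
    have : cesaroSolveAux z (c • x) = c • cesaroSolveAux z x := by
      funext n
      induction n with
      | zero => simp only [cesaroSolveAux, Pi.smul_apply, smul_eq_mul]; ring
      | succ n ih =>
        rw [Pi.smul_apply, smul_eq_mul] at ih
        simp only [cesaroSolveAux, Pi.smul_apply, smul_eq_mul, ih]
        ring
    rw [this, ← smul_add, smul_comm, RingHom.id_apply]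

lemma cesaroSolve_apply (z : ℂ) (x : ℕ → ℂ) (n : ℕ) :
    cesaroSolve z x n = z * (x n + cesaroSolveAux z x n) := rfl

lemma cesaroSolve_right {z : ℂ} (hz : z ≠ 0) (h1 : 1 - z ≠ 0)
    (h2 : ∀ n : ℕ, (n : ℂ) + 2 - z ≠ 0) (x : ℕ → ℂ) :
    z⁻¹ • cesaroSolve z x - cesaroSeq (cesaroSolve z x) = x := by
  have hC : cesaroSeq (cesaroSolve z x) = cesaroSolveAux z x := by
    refine cesaroSeq_eq_of_recurrence ?_ fun n => ?_
    · have : (1 - z) * cesaroSolveAux z x 0 = z * x 0 := by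
        rw [cesaroSolveAux, mul_div_cancel₀ _ h1]
      rw [cesaroSolve_apply]
      linear_combination this
    · have : ((n : ℂ) + 2 - z) * cesaroSolveAux z x (n + 1)
          = ((n : ℂ) + 1) * cesaroSolveAux z x n + z * x (n + 1) := by
        rw [cesaroSolveAux, mul_div_cancel₀ _ (h2 n)]
      rw [cesaroSolve_apply]
      linear_combination this
  rw [hC]
  funext n
  simp only [Pi.sub_apply, Pi.smul_apply, smul_eq_mul, cesaroSolve_apply]
  field_simp
  ring

/-- With nonzero denominators the recurrence has only one solution, and `C w` satisfies it. -/
lemma cesaroSolve_left {z : ℂ} (hz : z ≠ 0) (h1 : 1 - z ≠ 0)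
    (h2 : ∀ n : ℕ, (n : ℂ) + 2 - z ≠ 0) (w : ℕ → ℂ) :
    cesaroSolve z (z⁻¹ • w - cesaroSeq w) = w := by
  obtain ⟨e1, e2, e3⟩ := cesaroSeq_of_equation hz (w := w) rfl
  set x := z⁻¹ • w - cesaroSeq w with hx
  have hg : cesaroSolveAux z x = cesaroSeq w := by
    funext n
    induction n with
    | zero => rw [cesaroSolveAux, div_eq_iff h1]; linear_combination -e1
    | succ n ih => rw [cesaroSolveAux, div_eq_iff (h2 n), ih]; linear_combination -e2 n
  change z • (x + cesaroSolveAux z x) = w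
  rw [hg]
  exact e3.symm

/-! ### Bounds for the solution -/

lemma le_norm_sub_of_re {z : ℂ} {t : ℝ} : t - z.re ≤ ‖(t : ℂ) - z‖ := by
  have := Complex.re_le_norm ((t : ℂ) - z)
  simpa using this

/-- Multiplied out, the estimate remains true when the denominator vanishes and the quotient takes
its default value `0`. -/
lemma norm_cesaroSolveAux_zero (z : ℂ) (x : ℕ → ℂ) :
    ‖1 - z‖ * ‖cesaroSolveAux z x 0‖ ≤ ‖z‖ * ‖x 0‖ := by
  rw [cesaroSolveAux, norm_div, norm_mul]
  rcases eq_or_ne (1 - z) 0 with h | h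
  · rw [h]; simp; positivity
  · rw [mul_div_cancel₀ _ (norm_ne_zero_iff.2 h)]

lemma norm_cesaroSolveAux_succ (z : ℂ) (x : ℕ → ℂ) (n : ℕ) :
    ‖(n : ℂ) + 2 - z‖ * ‖cesaroSolveAux z x (n + 1)‖
      ≤ ((n : ℝ) + 1) * ‖cesaroSolveAux z x n‖ + ‖z‖ * ‖x (n + 1)‖ := by
  have hn : ‖(n : ℂ) + 1‖ = (n : ℝ) + 1 := by
    rw [← Nat.cast_succ, Complex.norm_natCast]; push_cast; rfl
  have hle : ‖((n : ℂ) + 1) * cesaroSolveAux z x n + z * x (n + 1)‖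
      ≤ ((n : ℝ) + 1) * ‖cesaroSolveAux z x n‖ + ‖z‖ * ‖x (n + 1)‖ := by
    refine (norm_add_le _ _).trans_eq ?_
    rw [norm_mul, norm_mul, hn]
  rw [cesaroSolveAux, norm_div]
  rcases eq_or_ne ((n : ℂ) + 2 - z) 0 with h | h
  · rw [h]; simp; positivity
  · rwa [mul_div_cancel₀ _ (norm_ne_zero_iff.2 h)]

lemma one_sub_re_le_norm (z : ℂ) : 1 - z.re ≤ ‖1 - z‖ := by
  simpa using le_norm_sub_of_re (z := z) (t := 1)

lemma add_two_sub_re_le_norm (z : ℂ) (n : ℕ) : (n : ℝ) + 2 - z.re ≤ ‖(n : ℂ) + 2 - z‖ := by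
  simpa using le_norm_sub_of_re (z := z) (t := (n : ℝ) + 2)

/-- The bound `G` satisfies `(1 - Re z) G = ‖z‖ N`, so it is stationary for the majorant recurrence:
`(n + 2 - Re z) G = (n + 1) G + ‖z‖ N`. Monotonicity of `v` lets the bound pass from `n` to `n + 1`.
-/
lemma cesaroSolveAux_bound_of_re_lt {z : ℂ} (hz : z.re < 1) {v : ℕ → ℝ} (hv : ∀ n, 0 < v n)
    (ha : Antitone v) {x : ℕ → ℂ} {N : ℝ} (hN : ∀ n, v n * ‖x n‖ ≤ N) (n : ℕ) :
    v n * ‖cesaroSolveAux z x n‖ ≤ ‖z‖ * N / (1 - z.re) := by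
  have h1 : 0 < 1 - z.re := by linarith
  rw [le_div_iff₀ h1]
  induction n with
  | zero =>
    have e1 := norm_cesaroSolveAux_zero z x
    have e2 := mul_le_mul_of_nonneg_right (one_sub_re_le_norm z)
      (norm_nonneg (cesaroSolveAux z x 0))
    calc v 0 * ‖cesaroSolveAux z x 0‖ * (1 - z.re)
        = v 0 * ((1 - z.re) * ‖cesaroSolveAux z x 0‖) := by ring
      _ ≤ v 0 * (‖z‖ * ‖x 0‖) := mul_le_mul_of_nonneg_left (e2.trans e1) (hv 0).le
      _ = ‖z‖ * (v 0 * ‖x 0‖) := by ring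
      _ ≤ ‖z‖ * N := mul_le_mul_of_nonneg_left (hN 0) (norm_nonneg z)
  | succ n ih =>
    have hn : (0 : ℝ) < n + 2 - z.re := by linarith [n.cast_nonneg (α := ℝ)]
    have e1 := norm_cesaroSolveAux_succ z x n
    have e2 := mul_le_mul_of_nonneg_right (add_two_sub_re_le_norm z n)
      (norm_nonneg (cesaroSolveAux z x (n + 1)))
    have e3 := mul_le_mul_of_nonneg_left (e2.trans e1) (hv (n + 1)).le
    have e4 : v (n + 1) * ‖cesaroSolveAux z x n‖ ≤ v n * ‖cesaroSolveAux z x n‖ :=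
      mul_le_mul_of_nonneg_right (ha n.le_succ) (norm_nonneg _)
    have e5 := mul_le_mul_of_nonneg_left (hN (n + 1)) (norm_nonneg z)
    have e6 : ((n : ℝ) + 1) * (v (n + 1) * ‖cesaroSolveAux z x n‖ * (1 - z.re))
        ≤ ((n : ℝ) + 1) * (‖z‖ * N) :=
      mul_le_mul_of_nonneg_left ((mul_le_mul_of_nonneg_right e4 h1.le).trans ih) (by positivity)
    have e7 := mul_le_mul_of_nonneg_right e5 h1.le
    have e8 := mul_le_mul_of_nonneg_right e3 h1.le
    refine le_of_mul_le_mul_left ?_ hn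
    linarith

/-- Now `‖n + 2 - z‖ ≥ n + 1`, so each step adds at most `‖z‖ N / (n + 1)` and the increments sum to
the harmonic number. At index `0` the real part gives no lower bound for the denominator, whence the
term `1 / ‖1 - z‖`. -/
lemma cesaroSolveAux_bound_of_re_eq {z : ℂ} (hz : z.re = 1) (hz1 : z ≠ 1) {v : ℕ → ℝ}
    (hv : ∀ n, 0 < v n) (ha : Antitone v) {x : ℕ → ℂ} {N : ℝ} (hN : ∀ n, v n * ‖x n‖ ≤ N)
    (n : ℕ) :
    v n * ‖cesaroSolveAux z x n‖ ≤ ‖z‖ * N * (1 / ‖1 - z‖ + (harmonic n : ℝ)) := by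
  induction n with
  | zero =>
    have h1 : 0 < ‖1 - z‖ := norm_pos_iff.2 (sub_ne_zero.2 hz1.symm)
    have e1 := norm_cesaroSolveAux_zero z x
    simp only [harmonic_zero, Rat.cast_zero, add_zero, mul_one_div]
    rw [le_div_iff₀ h1]
    calc v 0 * ‖cesaroSolveAux z x 0‖ * ‖1 - z‖
        = v 0 * (‖1 - z‖ * ‖cesaroSolveAux z x 0‖) := by ring
      _ ≤ v 0 * (‖z‖ * ‖x 0‖) := mul_le_mul_of_nonneg_left e1 (hv 0).le
      _ = ‖z‖ * (v 0 * ‖x 0‖) := by ring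
      _ ≤ ‖z‖ * N := mul_le_mul_of_nonneg_left (hN 0) (norm_nonneg z)
  | succ n ih =>
    have hn : (0 : ℝ) < n + 1 := by positivity
    have e1 := norm_cesaroSolveAux_succ z x n
    have e2 := mul_le_mul_of_nonneg_right (add_two_sub_re_le_norm z n)
      (norm_nonneg (cesaroSolveAux z x (n + 1)))
    have e3 := mul_le_mul_of_nonneg_left (e2.trans e1) (hv (n + 1)).le
    have e4 : v (n + 1) * ‖cesaroSolveAux z x n‖ ≤ v n * ‖cesaroSolveAux z x n‖ :=
      mul_le_mul_of_nonneg_right (ha n.le_succ) (norm_nonneg _)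
    have e5 := mul_le_mul_of_nonneg_left (hN (n + 1)) (norm_nonneg z)
    have e6 := mul_le_mul_of_nonneg_left (e4.trans ih) hn.le
    rw [hz] at e3
    rw [harmonic_succ]
    push_cast
    refine le_of_mul_le_mul_left ?_ hn
    have e7 : ((n : ℝ) + 1) * (‖z‖ * N * (1 / ‖1 - z‖ + ((harmonic n : ℝ) + ((n : ℝ) + 1)⁻¹)))
        = ((n : ℝ) + 1) * (‖z‖ * N * (1 / ‖1 - z‖ + (harmonic n : ℝ))) + ‖z‖ * N := by
      field_simp
      ring
    rw [e7]
    linarith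

/-! ### Growth of solutions of the homogeneous recurrence -/

/-- Write `n + 2 - z = (n + 1) + (1 - z)`, expand the squared modulus, and apply `1 + t ≤ exp t`. -/
lemma norm_add_two_sub_le (z : ℂ) (n : ℕ) :
    ‖(n : ℂ) + 2 - z‖ ≤ ((n : ℝ) + 1) *
      Real.exp ((1 - z.re) * ((n : ℝ) + 1)⁻¹ + ‖1 - z‖ ^ 2 / 2 * (1 / ((n : ℝ) + 1) ^ 2)) := by
  have hn : (0 : ℝ) < n + 1 := by positivity
  rw [← pow_le_pow_iff_left₀ (norm_nonneg _) (by positivity) two_ne_zero, mul_pow,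
    ← Real.exp_nat_mul]
  have h1 : ‖(n : ℂ) + 2 - z‖ ^ 2
      = ((n : ℝ) + 1) ^ 2 + 2 * ((n : ℝ) + 1) * (1 - z.re) + ‖1 - z‖ ^ 2 := by
    rw [← Complex.normSq_eq_norm_sq, ← Complex.normSq_eq_norm_sq, Complex.normSq_apply,
      Complex.normSq_apply]
    simp
    ring
  have h2 := Real.add_one_le_exp (((2 : ℕ) : ℝ) * ((1 - z.re) * ((n : ℝ) + 1)⁻¹
    + ‖1 - z‖ ^ 2 / 2 * (1 / ((n : ℝ) + 1) ^ 2)))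
  refine le_trans (le_of_eq ?_) (mul_le_mul_of_nonneg_left h2 (by positivity))
  rw [h1]
  push_cast
  field_simp
  ring

/-- Multiplying the one-step estimates, the first-order terms add up to `(1 - Re z) H_n`, while the
second-order ones are summable and go into `K`. Nothing is divided by `n + 2 - z`, so integer values
of `z` are included. -/
lemma exists_growth_bound (z : ℂ) : ∃ K, 0 < K ∧ ∀ u : ℕ → ℂ,
    (∀ n : ℕ, ((n : ℂ) + 2 - z) * u (n + 1) = ((n : ℂ) + 1) * u n) →
    ∀ n, Real.exp ((z.re - 1) * (harmonic n : ℝ)) * ‖u 0‖ ≤ K * ‖u n‖ := by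
  have hsq : Summable fun n : ℕ => 1 / ((n : ℝ) + 1) ^ 2 := by
    have := (summable_nat_add_iff 1).2 (Real.summable_one_div_nat_pow.2 one_lt_two)
    simpa using this
  set B := ‖1 - z‖ ^ 2 / 2 with hB
  refine ⟨Real.exp (B * ∑' n : ℕ, 1 / ((n : ℝ) + 1) ^ 2), Real.exp_pos _, fun u hu n => ?_⟩
  have key : Real.exp ((z.re - 1) * (harmonic n : ℝ)) * ‖u 0‖
      ≤ Real.exp (B * ∑ j ∈ Finset.range n, 1 / ((j : ℝ) + 1) ^ 2) * ‖u n‖ := by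
    induction n with
    | zero => simp
    | succ n ih =>
      have hn : (0 : ℝ) < n + 1 := by positivity
      have h1 : ‖(n : ℂ) + 2 - z‖ * ‖u (n + 1)‖ = ((n : ℝ) + 1) * ‖u n‖ := by
        rw [← norm_mul, hu n, norm_mul]
        congr 1
        rw [← Nat.cast_succ, Complex.norm_natCast]; push_cast; rfl
      have h2 : ‖u n‖ ≤ Real.exp ((1 - z.re) * ((n : ℝ) + 1)⁻¹ + B * (1 / ((n : ℝ) + 1) ^ 2))
          * ‖u (n + 1)‖ := by
        refine le_of_mul_le_mul_left ?_ hn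
        rw [← h1, ← mul_assoc]
        exact mul_le_mul_of_nonneg_right (norm_add_two_sub_le z n) (norm_nonneg _)
      rw [harmonic_succ, Finset.sum_range_succ]
      push_cast
      calc Real.exp ((z.re - 1) * ((harmonic n : ℝ) + ((n : ℝ) + 1)⁻¹)) * ‖u 0‖
          = Real.exp ((z.re - 1) * ((n : ℝ) + 1)⁻¹)
            * (Real.exp ((z.re - 1) * (harmonic n : ℝ)) * ‖u 0‖) := by
            rw [mul_add, Real.exp_add]; ring
        _ ≤ Real.exp ((z.re - 1) * ((n : ℝ) + 1)⁻¹)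
            * (Real.exp (B * ∑ j ∈ Finset.range n, 1 / ((j : ℝ) + 1) ^ 2)
            * (Real.exp ((1 - z.re) * ((n : ℝ) + 1)⁻¹ + B * (1 / ((n : ℝ) + 1) ^ 2))
            * ‖u (n + 1)‖)) := mul_le_mul_of_nonneg_left
              (ih.trans (mul_le_mul_of_nonneg_left h2 (Real.exp_pos _).le)) (Real.exp_pos _).le
        _ = Real.exp ((z.re - 1) * ((n : ℝ) + 1)⁻¹
            + (B * ∑ j ∈ Finset.range n, 1 / ((j : ℝ) + 1) ^ 2
            + ((1 - z.re) * ((n : ℝ) + 1)⁻¹ + B * (1 / ((n : ℝ) + 1) ^ 2)))) * ‖u (n + 1)‖ := by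
            simp only [Real.exp_add, mul_assoc]
        _ = _ := by congr 2; ring
  refine key.trans (mul_le_mul_of_nonneg_right (Real.exp_le_exp.2 ?_) (norm_nonneg _))
  exact mul_le_mul_of_nonneg_left (hsq.sum_le_tsum _ fun j _ => by positivity) (by positivity)

/-- Elements of `E_α` grow at most like `exp (A α_n)`. -/
lemma exists_le_mul_of_exp_le (hα_pos : ∀ n, 0 < α n) (hα : StrictMono α) (hs1 : ∀ k, 1 < s k)
    (hs : StrictMono s) {g : ℕ → ℂ} (hg : g ∈ coechelonSubmodule α s) {L : ℕ → ℝ} {K K' : ℝ}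
    (hK : 0 ≤ K) (hK' : 0 ≤ K') (h : ∀ n, Real.exp (L n) ≤ K * ‖g n‖ + K') :
    ∃ A, ∀ n, L n ≤ A * α n := by
  obtain ⟨k, M, hM⟩ := exists_bound_of_mem hα_pos hs1 hs hg
  have hk : 0 < s k := by linarith [hs1 k]
  -- The bound `1 + t ≤ exp t` replaces a logarithm, and the remaining constant is at most a
  -- multiple of `α n` because `α 0 ≤ α n`.
  refine ⟨Real.log (s k) + |K * M + K'| / α 0, fun n => ?_⟩
  have hv1 : coWeight α s k n ≤ 1 :=
    Real.rpow_le_one_of_one_le_of_nonpos (hs1 k).le (by linarith [hα_pos n])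
  have h1 : coWeight α s k n * Real.exp (L n) ≤ K * M + K' := by
    calc coWeight α s k n * Real.exp (L n)
        ≤ coWeight α s k n * (K * ‖g n‖ + K') :=
          mul_le_mul_of_nonneg_left (h n) (coWeight_pos hs1 k n).le
      _ = K * (coWeight α s k n * ‖g n‖) + coWeight α s k n * K' := by ring
      _ ≤ K * M + 1 * K' := add_le_add (mul_le_mul_of_nonneg_left (hM n) hK)
          (mul_le_mul_of_nonneg_right hv1 hK')
      _ = K * M + K' := by ring
  rw [coWeight, Real.rpow_def_of_pos hk, ← Real.exp_add] at h1
  have h2 := Real.add_one_le_exp (Real.log (s k) * -α n + L n)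
  have h3 : |K * M + K'| ≤ |K * M + K'| / α 0 * α n := by
    rw [div_mul_eq_mul_div, le_div_iff₀ (hα_pos 0)]
    exact mul_le_mul_of_nonneg_left (hα.monotone n.zero_le) (abs_nonneg _)
  linarith [le_abs_self (K * M + K')]

/-! ### Points of the resolvent set -/

/-- The algebraic inverse on `ℂ^ℕ` restricts to `E_α`. The formula for the resolvent is kept because
equicontinuity is read off from it. -/
lemma mem_resolventSet_cesaro (hα_pos : ∀ n, 0 < α n) (hα : StrictMono α)
    (hα_lim : Tendsto α atTop atTop) (hs1 : ∀ k, 1 < s k) (hs : StrictMono s) {μ : ℂ} (hμ : μ ≠ 0)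
    (h1 : 1 - μ⁻¹ ≠ 0) (h2 : ∀ n : ℕ, (n : ℂ) + 2 - μ⁻¹ ≠ 0)
    (hT : UniformlyStepBounded α s (fun _ : Unit => cesaroSolve μ⁻¹)) :
    μ ∈ resolventSet ℂ (cesaro hα hs1) ∧
      ∀ x, (resolvent (cesaro hα hs1) μ x).1 = cesaroSolve μ⁻¹ x.1 := by
  obtain ⟨S, hS⟩ := hT.exists_clm hα_pos hα_lim hs1 hs
  set T := algebraMap ℂ (CoechelonSpace α s →L[ℂ] CoechelonSpace α s) μ - cesaro hα hs1 with hTdef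
  have hTapp : ∀ x, (T x).1 = μ • x.1 - cesaroSeq x.1 := fun x => rfl
  have hTS : T * S = 1 := by
    ext x
    refine Subtype.ext ?_
    change (T (S x)).1 = x.1
    rw [hTapp, hS]
    simpa using cesaroSolve_right (inv_ne_zero hμ) h1 h2 x.1
  have hST : S * T = 1 := by
    ext x
    refine Subtype.ext ?_
    change (S (T x)).1 = x.1
    rw [hS, hTapp]
    simpa using cesaroSolve_left (inv_ne_zero hμ) h1 h2 x.1
  let U : (CoechelonSpace α s →L[ℂ] CoechelonSpace α s)ˣ := ⟨T, S, hTS, hST⟩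
  refine ⟨⟨U, rfl⟩, fun x => ?_⟩
  have : resolvent (cesaro hα hs1) μ = S := Ring.inverse_unit U
  rw [this, hS]

lemma one_sub_ne_zero_of_re_lt {z : ℂ} (hz : z.re < 1) : 1 - z ≠ 0 := by
  intro h
  have := one_sub_re_le_norm z
  rw [h, norm_zero] at this
  linarith

lemma add_two_sub_ne_zero_of_re_le {z : ℂ} (hz : z.re ≤ 1) (n : ℕ) : (n : ℂ) + 2 - z ≠ 0 := by
  intro h
  have := add_two_sub_re_le_norm z n
  rw [h, norm_zero] at this
  linarith [n.cast_nonneg (α := ℝ)]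

lemma uniformlyStepBounded_cesaroSolve (hα : StrictMono α) (hs1 : ∀ k, 1 < s k) {ι : Type*}
    {z : ι → ℂ} {K r : ℝ} (hr : r < 1) (hz : ∀ i, (z i).re ≤ r) (hK : ∀ i, ‖z i‖ ≤ K) :
    UniformlyStepBounded α s (fun i => cesaroSolve (z i)) := by
  intro k
  refine ⟨k, K * (1 + K / (1 - r)), fun i x N hN n => ?_⟩
  have hv := coWeight_pos hs1 (α := α) k
  have hN0 : 0 ≤ N := (mul_nonneg (hv 0).le (norm_nonneg _)).trans (hN 0)
  have hK0 : 0 ≤ K := (norm_nonneg _).trans (hK i)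
  have h1r : 0 < 1 - r := by linarith
  have h1 := cesaroSolveAux_bound_of_re_lt ((hz i).trans_lt hr) hv (coWeight_anti hα hs1 k) hN n
  have h2 : ‖z i‖ * N / (1 - (z i).re) ≤ K * N / (1 - r) := by
    have := hK i
    have := hz i
    gcongr
  calc coWeight α s k n * ‖cesaroSolve (z i) x n‖
      ≤ coWeight α s k n * (‖z i‖ * (‖x n‖ + ‖cesaroSolveAux (z i) x n‖)) := by
        rw [cesaroSolve_apply, norm_mul]
        have := (hv n).le
        gcongr
        exact norm_add_le _ _
    _ = ‖z i‖ * (coWeight α s k n * ‖x n‖ + coWeight α s k n * ‖cesaroSolveAux (z i) x n‖) := by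
        ring
    _ ≤ K * (N + K * N / (1 - r)) := by
        have := (hv n).le
        exact mul_le_mul (hK i) (add_le_add (hN n) (h1.trans h2)) (by positivity) hK0
    _ = K * (1 + K / (1 - r)) * N := by ring

/-- The hypothesis turns the logarithmic loss `H_n` into a factor `2 exp (A α_n)`, which costs a
change of step from `k` to `l`. -/
lemma uniformlyStepBounded_cesaroSolve_of_re_eq (hα_pos : ∀ n, 0 < α n) (hα : StrictMono α)
    (hs1 : ∀ k, 1 < s k) (hs_lim : Tendsto s atTop atTop)
    (hb : BddAbove (range fun n : ℕ => Real.log (Real.log ((n : ℝ) + 1)) / α n))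
    {z : ℂ} (hz : z.re = 1) (hz1 : z ≠ 1) :
    UniformlyStepBounded α s (fun _ : Unit => cesaroSolve z) := by
  obtain ⟨A₀, hA₀⟩ := hb
  -- Nonnegativity makes `exp (A α_n) ≥ 1`, so bounded terms are absorbed as well.
  set A := max A₀ 0
  have hA : ∀ n : ℕ, Real.log ((n : ℝ) + 1) ≤ Real.exp (A * α n) := by
    intro n
    rcases n.eq_zero_or_pos with rfl | hn
    · simpa using (Real.exp_pos _).le
    · have h1 : Real.log (Real.log ((n : ℝ) + 1)) / α n ≤ A :=
        (hA₀ ⟨n, rfl⟩).trans (le_max_left _ _)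
      rw [div_le_iff₀ (hα_pos n)] at h1
      have h2 : 0 < Real.log ((n : ℝ) + 1) :=
        Real.log_pos (by have : (0 : ℝ) < n := by exact_mod_cast hn
                         linarith)
      rw [← Real.exp_log h2]
      exact Real.exp_le_exp.2 h1
  have hA1 : ∀ n, 1 ≤ Real.exp (A * α n) := fun n =>
    Real.one_le_exp (mul_nonneg (le_max_right _ _) (hα_pos n).le)
  have hH : ∀ n, (harmonic n : ℝ) ≤ 2 * Real.exp (A * α n) := by
    intro n
    have h1 := harmonic_le_one_add_log n
    have h2 : Real.log (n : ℝ) ≤ Real.log ((n : ℝ) + 1) := by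
      rcases n.eq_zero_or_pos with rfl | hn
      · simp
      · exact Real.log_le_log (by exact_mod_cast hn) (by linarith)
    linarith [hA n, hA1 n]
  intro k
  obtain ⟨l, hl⟩ := exists_mul_exp_le hs_lim k A
  set c := 1 / ‖1 - z‖ with hc
  have hc0 : 0 ≤ c := by positivity
  refine ⟨l, ‖z‖ * (1 + ‖z‖ * (c + 2)), fun _ x N hN n => ?_⟩
  have hv := coWeight_pos hs1 (α := α) k
  have hvl := coWeight_pos hs1 (α := α) l n
  have hN0 : 0 ≤ N := (mul_nonneg (hv 0).le (norm_nonneg _)).trans (hN 0)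
  have hg := cesaroSolveAux_bound_of_re_eq hz hz1 hv (coWeight_anti hα hs1 k) hN n
  have hw := coWeight_mul_le hα_pos hs1 hl n
  set E := Real.exp (A * α n) with hE
  have hE0 : 0 < E := Real.exp_pos _
  have h1 : coWeight α s k n * ‖x n‖ + coWeight α s k n * ‖cesaroSolveAux z x n‖
      ≤ (N + ‖z‖ * N * (c + 2)) * E := by
    have e1 : N ≤ N * E := le_mul_of_one_le_right hN0 (hA1 n)
    have e2 : c + (harmonic n : ℝ) ≤ (c + 2) * E := by
      have := le_mul_of_one_le_right hc0 (hA1 n)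
      have := hH n
      linarith
    have e3 := mul_le_mul_of_nonneg_left e2 (mul_nonneg (norm_nonneg z) hN0)
    linarith [hN n]
  have h2 : coWeight α s l n * E * (‖x n‖ + ‖cesaroSolveAux z x n‖)
      ≤ (N + ‖z‖ * N * (c + 2)) * E := by
    refine (mul_le_mul_of_nonneg_right hw (by positivity)).trans ?_
    rw [mul_add]
    exact h1
  have h3 : coWeight α s l n * (‖x n‖ + ‖cesaroSolveAux z x n‖) ≤ N + ‖z‖ * N * (c + 2) := by
    refine le_of_mul_le_mul_right ?_ hE0
    linarith
  calc coWeight α s l n * ‖cesaroSolve z x n‖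
      ≤ coWeight α s l n * (‖z‖ * (‖x n‖ + ‖cesaroSolveAux z x n‖)) := by
        rw [cesaroSolve_apply, norm_mul]
        gcongr
        exact norm_add_le _ _
    _ = ‖z‖ * (coWeight α s l n * (‖x n‖ + ‖cesaroSolveAux z x n‖)) := by ring
    _ ≤ ‖z‖ * (N + ‖z‖ * N * (c + 2)) := mul_le_mul_of_nonneg_left h3 (norm_nonneg z)
    _ = ‖z‖ * (1 + ‖z‖ * (c + 2)) * N := by ring

/-- Points `μ` with `Re (1/μ) < 1` belong to `ρ*(C)`. -/
lemma mem_starResolventSet_cesaro (hα_pos : ∀ n, 0 < α n) (hα : StrictMono α)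
    (hα_lim : Tendsto α atTop atTop) (hs1 : ∀ k, 1 < s k) (hs : StrictMono s) {μ : ℂ}
    (hμ : μ ≠ 0) (hre : (μ⁻¹).re < 1) : μ ∈ starResolventSet (cesaro hα hs1) := by
  obtain ⟨r, hr, hr1⟩ := exists_between hre
  have hcont : Tendsto (fun w : ℂ => w⁻¹) (𝓝 μ) (𝓝 μ⁻¹) := tendsto_inv₀ hμ
  have hev : ∀ᶠ w in 𝓝 μ, w ≠ 0 ∧ (w⁻¹).re < r ∧ ‖w⁻¹‖ < ‖μ⁻¹‖ + 1 :=
    (eventually_ne_nhds hμ).and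
      ((((Complex.continuous_re.tendsto _).comp hcont).eventually_lt_const hr).and
        (hcont.norm.eventually_lt_const (lt_add_one _)))
  obtain ⟨δ, hδ, hball⟩ := Metric.eventually_nhds_iff_ball.1 hev
  have hres : ∀ w ∈ Metric.ball μ δ, w ∈ resolventSet ℂ (cesaro hα hs1) ∧
      ∀ x, (resolvent (cesaro hα hs1) w x).1 = cesaroSolve w⁻¹ x.1 := by
    intro w hw
    obtain ⟨h0, h1, h2⟩ := hball w hw
    exact mem_resolventSet_cesaro hα_pos hα hα_lim hs1 hs h0
      (one_sub_ne_zero_of_re_lt (h1.trans hr1)) (add_two_sub_ne_zero_of_re_le (h1.trans hr1).le)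
      (uniformlyStepBounded_cesaroSolve hα hs1 hr1 (fun _ => h1.le) (fun _ => h2.le))
  refine ⟨δ, hδ, fun w hw => (hres w hw).1, fun V hV => ?_⟩
  have hT : UniformlyStepBounded α s (fun w : Metric.ball μ δ => cesaroSolve (w : ℂ)⁻¹) :=
    uniformlyStepBounded_cesaroSolve hα hs1 hr1 (fun w => (hball w w.2).2.1.le)
      (fun w => (hball w w.2).2.2.le)
  obtain ⟨U, hU, h⟩ := hT.equicontinuous hα_pos hα_lim hs1 hs
    (fun w => (resolvent (cesaro hα hs1) (w : ℂ)).toLinearMap) (fun w => (hres w w.2).2) V hV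
  exact ⟨U, hU, fun w hw x hx => h ⟨w, hw⟩ x hx⟩

/-! ### Points of the spectrum -/

/-- Every spectral point below is detected through failure of surjectivity. -/
lemma exists_solution_of_notMem_spectrum {hα : StrictMono α} {hs1 : ∀ k, 1 < s k} {μ : ℂ}
    (h : μ ∉ spectrum ℂ (cesaro hα hs1)) {x : ℕ → ℂ} (hx : x ∈ coechelonSubmodule α s) :
    ∃ w ∈ coechelonSubmodule α s, μ • w - cesaroSeq w = x := by
  obtain ⟨U, hU⟩ := spectrum.notMem_iff.1 h
  let y : CoechelonSpace α s := (⟨x, hx⟩ : coechelonSubmodule α s)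
  have h1 : (U.val * U.inv) y = y := by rw [U.val_inv]; rfl
  rw [hU] at h1
  exact ⟨(U.inv y).1, (U.inv y).2, congrArg Subtype.val h1⟩

lemma mem_coechelonSubmodule_of_norm_le_one (hα_pos : ∀ n, 0 < α n)
    (hα_lim : Tendsto α atTop atTop) (hs1 : ∀ k, 1 < s k) (hs : StrictMono s) {x : ℕ → ℂ}
    (h : ∀ n, ‖x n‖ ≤ 1) : x ∈ coechelonSubmodule α s := by
  refine mem_coechelonSubmodule_of_bound hα_lim hs1 hs (k := 0) (M := 1) fun n => ?_
  exact mul_le_one₀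
    (Real.rpow_le_one_of_one_le_of_nonpos (hs1 0).le (by linarith [hα_pos n]))
    (norm_nonneg _) (h n)

/-- If the means alternate between `1` and `-1`, the sequence itself has modulus `2 n + 1` at index
`n`; membership in `E_α` would then force `log n = O(α_n)`. -/
lemma zero_mem_spectrum_cesaro (hα_pos : ∀ n, 0 < α n) (hα : StrictMono α)
    (hα_lim : Tendsto α atTop atTop) (hs1 : ∀ k, 1 < s k) (hs : StrictMono s)
    (hlog : ¬ ∃ A, ∀ n : ℕ, Real.log ((n : ℝ) + 1) ≤ A * α n) :
    0 ∈ spectrum ℂ (cesaro hα hs1) := by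
  by_contra h
  obtain ⟨w, hw, hwx⟩ := exists_solution_of_notMem_spectrum h
    (mem_coechelonSubmodule_of_norm_le_one hα_pos hα_lim hs1 hs
      (x := fun n => (-1 : ℂ) ^ n) (fun n => by simp))
  have hC : ∀ n, cesaroSeq w n = -(-1 : ℂ) ^ n := fun n => by
    have := congrFun hwx n
    simp only [zero_smul, zero_sub, Pi.neg_apply] at this
    rw [← this, neg_neg]
  refine hlog (exists_le_mul_of_exp_le hα_pos hα hs1 hs hw zero_le_one le_rfl fun n => ?_)
  rw [Real.exp_log (by positivity), one_mul, add_zero]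
  cases n with
  | zero =>
    rw [← cesaroSeq_zero_apply w, hC]
    simp
  | succ n =>
    have h1 := cesaroSeq_succ_apply w n
    rw [hC, hC] at h1
    have h2 : w (n + 1) = (((2 * n + 3 : ℕ) : ℂ)) * (-1) ^ n := by
      push_cast
      linear_combination -h1
    rw [h2, norm_mul, norm_pow, norm_neg, norm_one, one_pow, mul_one, Complex.norm_natCast]
    push_cast
    linarith [n.cast_nonneg (α := ℝ)]

/-- With right-hand side `e_0`, the means solve the homogeneous recurrence with nonzero initial
value, so they grow at least like `exp ((Re z - 1) H_n)`, too fast for `E_α`. -/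
lemma mem_spectrum_cesaro_of_re_gt (hα_pos : ∀ n, 0 < α n) (hα : StrictMono α)
    (hα_lim : Tendsto α atTop atTop) (hs1 : ∀ k, 1 < s k) (hs : StrictMono s)
    (hlog : ¬ ∃ A, ∀ n : ℕ, Real.log ((n : ℝ) + 1) ≤ A * α n) {μ : ℂ} (hμ : μ ≠ 0)
    (hre : μ = 1 ∨ 1 < (μ⁻¹).re) : μ ∈ spectrum ℂ (cesaro hα hs1) := by
  by_contra h
  obtain ⟨w, hw, hwx⟩ := exists_solution_of_notMem_spectrum h
    (mem_coechelonSubmodule_of_norm_le_one hα_pos hα_lim hs1 hs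
      (x := Pi.single 0 1) (fun n => by
        rcases eq_or_ne n 0 with rfl | hn
        · simp
        · simp [Pi.single_eq_of_ne hn]))
  set z := μ⁻¹ with hz
  have hz0 : z ≠ 0 := inv_ne_zero hμ
  rw [← inv_inv μ] at hwx
  obtain ⟨e1, e2, -⟩ := cesaroSeq_of_equation hz0 hwx
  rw [Pi.single_eq_same, mul_one] at e1
  have hg0 : cesaroSeq w 0 ≠ 0 := fun h0 => by
    rw [h0, mul_zero] at e1
    exact hz0 e1.symm
  -- For `μ = 1` the initial equation reads `0 = 1`.
  rcases hre with rfl | hre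
  · simp [hz] at e1
  obtain ⟨K, hK, hgrow⟩ := exists_growth_bound z
  have hb := hgrow (cesaroSeq w) fun n => by
    rw [e2 n, Pi.single_eq_of_ne n.succ_ne_zero, mul_zero, add_zero]
  have hpos : 0 < ‖cesaroSeq w 0‖ := norm_pos_iff.2 hg0
  obtain ⟨A, hA⟩ := exists_le_mul_of_exp_le hα_pos hα hs1 hs (cesaroSeq_mem_coechelon hα hs1 w hw)
    (L := fun n => (z.re - 1) * (harmonic n : ℝ)) (K := K / ‖cesaroSeq w 0‖) (K' := 0)
    (by positivity) le_rfl fun n => by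
      rw [add_zero, div_mul_eq_mul_div, le_div_iff₀ hpos]
      exact hb n
  have hr : 0 < z.re - 1 := by linarith
  refine hlog ⟨A / (z.re - 1), fun n => ?_⟩
  rw [div_mul_eq_mul_div, le_div_iff₀ hr]
  have h1 := log_add_one_le_harmonic n
  push_cast at h1
  have := mul_le_mul_of_nonneg_left h1 hr.le
  linarith [hA n]

/-- The solution of the homogeneous recurrence `(n + 1 - z) u_n = n u_{n-1}` with `u_0 = 1`. -/
def homogeneousSolution (z : ℂ) : ℕ → ℂ
  | 0 => 1
  | n + 1 => ((n : ℂ) + 1) * homogeneousSolution z n / ((n : ℂ) + 2 - z)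

lemma norm_homogeneousSolution_le_one {z : ℂ} (hz : z.re ≤ 1) (n : ℕ) :
    ‖homogeneousSolution z n‖ ≤ 1 := by
  induction n with
  | zero => simp [homogeneousSolution]
  | succ n ih =>
    have h1 : (0 : ℝ) < ‖(n : ℂ) + 2 - z‖ := norm_pos_iff.2 (add_two_sub_ne_zero_of_re_le hz n)
    have h2 : ‖(n : ℂ) + 1‖ = (n : ℝ) + 1 := by
      rw [← Nat.cast_succ, Complex.norm_natCast]; push_cast; rfl
    rw [homogeneousSolution, norm_div, norm_mul, h2, div_le_one h1]
    have h3 : ((n : ℝ) + 1) * ‖homogeneousSolution z n‖ ≤ (n : ℝ) + 1 :=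
      mul_le_of_le_one_right (by positivity) ih
    linarith [add_two_sub_re_le_norm z n]

/-- Resonance: when the forcing is the shifted homogeneous solution `u`, the response is `z H_n
u_n`. On `Re z = 1` the modulus of `u` is bounded above, so the forcing lies in `E_α`, and below, so
the response grows like `log n`. -/
lemma mem_spectrum_cesaro_of_re_eq (hα_pos : ∀ n, 0 < α n) (hα : StrictMono α)
    (hα_lim : Tendsto α atTop atTop) (hs1 : ∀ k, 1 < s k) (hs : StrictMono s)
    (hb : ¬ BddAbove (range fun n : ℕ => Real.log (Real.log ((n : ℝ) + 1)) / α n))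
    {μ : ℂ} (hμ : μ ≠ 0) (hμ1 : μ ≠ 1) (hre : (μ⁻¹).re = 1) :
    μ ∈ spectrum ℂ (cesaro hα hs1) := by
  by_contra h
  set z := μ⁻¹ with hz
  have hz0 : z ≠ 0 := inv_ne_zero hμ
  have hz1 : 1 - z ≠ 0 := sub_ne_zero.2 fun h => hμ1 (by rw [← inv_inv μ, ← hz, ← h, inv_one])
  set u := homogeneousSolution z with hu
  let x : ℕ → ℂ := fun n => Nat.casesOn n 0 u
  obtain ⟨w, hw, hwx⟩ := exists_solution_of_notMem_spectrum h
    (mem_coechelonSubmodule_of_norm_le_one hα_pos hα_lim hs1 hs (x := x) (fun n => by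
        cases n with
        | zero => simp [x]
        | succ n => exact norm_homogeneousSolution_le_one hre.le n))
  rw [← inv_inv μ] at hwx
  obtain ⟨e1, e2, -⟩ := cesaroSeq_of_equation hz0 hwx
  have hrec : ∀ n : ℕ, ((n : ℂ) + 2 - z) * u (n + 1) = ((n : ℂ) + 1) * u n := fun n => by
    rw [hu, homogeneousSolution, mul_div_cancel₀ _ (add_two_sub_ne_zero_of_re_le hre.le n)]
  have hg : ∀ n, cesaroSeq w n = z * ((harmonic n : ℚ) : ℂ) * u n := by
    intro n
    induction n with
    | zero =>
      have h0 : cesaroSeq w 0 = 0 := by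
        have : (1 - z) * cesaroSeq w 0 = 0 := by rw [e1]; simp [x]
        exact (mul_eq_zero.1 this).resolve_left hz1
      simp [h0]
    | succ n ih =>
      refine mul_left_cancel₀ (add_two_sub_ne_zero_of_re_le hre.le n) ?_
      have hn : (n : ℂ) + 1 ≠ 0 := n.cast_add_one_ne_zero
      rw [e2 n, ih, harmonic_succ]
      push_cast
      change _ + z * u n = _
      have := hrec n
      have h3 : ((n : ℂ) + 1) * ((n : ℂ) + 1)⁻¹ = 1 := mul_inv_cancel₀ hn
      linear_combination (-z * (((harmonic n : ℚ) : ℂ) + ((n : ℂ) + 1)⁻¹)) * this - z * u n * h3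
  obtain ⟨K, hK, hgrow⟩ := exists_growth_bound z
  have hlow : ∀ n, 1 ≤ K * ‖u n‖ := fun n => by
    have := hgrow u hrec n
    rw [hre, sub_self, zero_mul, Real.exp_zero, one_mul] at this
    simpa [hu, homogeneousSolution] using this
  have hzn : 0 < ‖z‖ := norm_pos_iff.2 hz0
  obtain ⟨A, hA⟩ := exists_le_mul_of_exp_le hα_pos hα hs1 hs (cesaroSeq_mem_coechelon hα hs1 w hw)
    (L := fun n => Real.log (Real.log ((n : ℝ) + 1))) (K := K / ‖z‖) (K' := 1)
    (by positivity) zero_le_one fun n => by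
      -- At `n = 0` the double logarithm has the default value `log 0 = 0`, whose exponential `1` is
      -- covered by `K' = 1`.
      rcases n.eq_zero_or_pos with rfl | hn
      · simp; positivity
      have hn' : (0 : ℝ) < n := by exact_mod_cast hn
      rw [Real.exp_log (Real.log_pos (by linarith))]
      have h1 := log_add_one_le_harmonic n
      push_cast at h1
      have hH : (0 : ℝ) ≤ (harmonic n : ℝ) := (Real.log_nonneg (by linarith)).trans h1
      have h2 : ‖(((harmonic n : ℚ) : ℂ))‖ = (harmonic n : ℝ) := by
        rw [show (((harmonic n : ℚ) : ℂ)) = (((harmonic n : ℚ) : ℝ) : ℂ) by push_cast; rfl,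
          Complex.norm_real, Real.norm_of_nonneg hH]
      rw [hg, norm_mul, norm_mul, h2]
      have h3 : K / ‖z‖ * (‖z‖ * (harmonic n : ℝ) * ‖u n‖)
          = (harmonic n : ℝ) * (K * ‖u n‖) := by field_simp
      rw [h3]
      have := le_mul_of_one_le_right hH (hlow n)
      linarith
  refine hb ⟨A, ?_⟩
  rintro _ ⟨n, rfl⟩
  exact (div_le_iff₀ (hα_pos n)).2 (hA n)

/-! ### The spectra -/

/-- `ρ*` lies in `ρ` and is open: a disc that works for `μ` contains a smaller one about each of its
points. -/
lemma closure_spectrum_subset_starSpectrum {X : Type*} [AddCommGroup X] [Module ℂ X]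
    [TopologicalSpace X] [IsTopologicalAddGroup X] [ContinuousSMul ℂ X] (T : X →L[ℂ] X) :
    closure (spectrum ℂ T) ⊆ starSpectrum T := by
  refine closure_minimal (fun μ hμ hstar => ?_) ?_
  · obtain ⟨δ, hδ, hsub, -⟩ := hstar
    exact hμ (hsub (Metric.mem_ball_self hδ))
  · rw [starSpectrum, isClosed_compl_iff, Metric.isOpen_iff]
    rintro μ ⟨δ, hδ, hsub, heq⟩
    refine ⟨δ, hδ, fun w hw => ?_⟩
    have hw' : Metric.ball w (δ - dist w μ) ⊆ Metric.ball μ δ :=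
      Metric.ball_subset_ball' (by linarith)
    refine ⟨δ - dist w μ, sub_pos.2 hw, hw'.trans hsub, fun V hV => ?_⟩
    obtain ⟨U, hU, h⟩ := heq V hV
    exact ⟨U, hU, fun ν hν => h ν (hw' hν)⟩

/-! ### The disc `D(1)` and its closure in terms of `Re (1/μ)` -/

lemma cesaroDisc_one_eq_ball : cesaroDisc 1 = Metric.ball (1 / 2 : ℂ) (1 / 2) := by
  ext μ
  simp [cesaroDisc, dist_eq_norm]

/-- Compares `|μ|²` with `Re μ`; for `μ ≠ 0` this is the comparison of `Re (1/μ)` with `1`. -/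
lemma norm_sub_half_sq (μ : ℂ) : ‖μ - 1 / 2‖ ^ 2 = Complex.normSq μ - μ.re + (1 / 2) ^ 2 := by
  rw [← Complex.normSq_eq_norm_sq, Complex.normSq_apply, Complex.normSq_apply]
  simp
  ring

lemma mem_cesaroDisc_one_iff {μ : ℂ} : μ ∈ cesaroDisc 1 ↔ Complex.normSq μ < μ.re := by
  rw [cesaroDisc_one_eq_ball, Metric.mem_ball, dist_eq_norm,
    ← pow_lt_pow_iff_left₀ (norm_nonneg _) (by norm_num) two_ne_zero, norm_sub_half_sq]
  constructor <;> intro h <;> linarith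

lemma mem_closure_cesaroDisc_one_iff {μ : ℂ} :
    μ ∈ closure (cesaroDisc 1) ↔ Complex.normSq μ ≤ μ.re := by
  rw [cesaroDisc_one_eq_ball, closure_ball _ (by norm_num), Metric.mem_closedBall, dist_eq_norm,
    ← pow_le_pow_iff_left₀ (norm_nonneg _) (by norm_num) two_ne_zero, norm_sub_half_sq]
  constructor <;> intro h <;> linarith

end

theorem proposition3p4
    (α : ℕ → ℝ) (hα_pos : ∀ n, 0 < α n) (hα : StrictMono α) (hα_lim : Tendsto α atTop atTop)
    (s : ℕ → ℝ) (hs_one : ∀ k, 1 < s k) (hs : StrictMono s) (hs_lim : Tendsto s atTop atTop)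
    (hE : ¬ IsNuclearSpace (CoechelonSpace α s)) :
    (BddAbove (range fun n : ℕ => Real.log (Real.log ((n : ℝ) + 1)) / α n) →
      spectrum ℂ (cesaro hα hs_one) = {0, 1} ∪ cesaroDisc 1 ∧
      starSpectrum (cesaro hα hs_one) = closure (cesaroDisc 1)) ∧
    (¬ BddAbove (range fun n : ℕ => Real.log (Real.log ((n : ℝ) + 1)) / α n) →
      spectrum ℂ (cesaro hα hs_one) = closure (cesaroDisc 1) ∧
      starSpectrum (cesaro hα hs_one) = closure (cesaroDisc 1)) := by
  -- The only place where non-nuclearity enters.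
  have hlog : ¬ ∃ A, ∀ n : ℕ, Real.log ((n : ℝ) + 1) ≤ A * α n := fun ⟨A, hA⟩ =>
    hE (isNuclearSpace_of_log_le hα_pos hs_one hs hs_lim hA)
  have hzero := zero_mem_spectrum_cesaro hα_pos hα hα_lim hs_one hs hlog
  have hone : (1 : ℂ) ∈ spectrum ℂ (cesaro hα hs_one) :=
    mem_spectrum_cesaro_of_re_gt hα_pos hα hα_lim hs_one hs hlog one_ne_zero (Or.inl rfl)
  have hdisc : cesaroDisc 1 ⊆ spectrum ℂ (cesaro hα hs_one) := by
    intro μ hμ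
    rcases eq_or_ne μ 0 with rfl | h0
    · exact hzero
    refine mem_spectrum_cesaro_of_re_gt hα_pos hα hα_lim hs_one hs hlog h0 (Or.inr ?_)
    rw [Complex.inv_re, one_lt_div (Complex.normSq_pos.2 h0)]
    exact mem_cesaroDisc_one_iff.1 hμ
  have hsub : spectrum ℂ (cesaro hα hs_one) ⊆ starSpectrum (cesaro hα hs_one) :=
    subset_closure.trans (closure_spectrum_subset_starSpectrum _)
  have hstar : starSpectrum (cesaro hα hs_one) = closure (cesaroDisc 1) := by
    refine Subset.antisymm (fun μ hμ => ?_)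
      ((closure_mono hdisc).trans (closure_spectrum_subset_starSpectrum _))
    by_contra hcl
    rw [mem_closure_cesaroDisc_one_iff, not_le] at hcl
    have h0 : μ ≠ 0 := fun h => by simp [h] at hcl
    refine hμ (mem_starResolventSet_cesaro hα_pos hα hα_lim hs_one hs h0 ?_)
    rw [Complex.inv_re, div_lt_one (Complex.normSq_pos.2 h0)]
    exact hcl
  -- With `σ*` settled, only the bounding circle without `0` and `1` is left to decide; there `Re
  -- (1/μ) = 1`.
  have hbd : ∀ μ : ℂ, μ ≠ 0 → μ ∈ closure (cesaroDisc 1) → μ ∉ cesaroDisc 1 → (μ⁻¹).re = 1 := by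
    intro μ h0 h1 h2
    rw [mem_closure_cesaroDisc_one_iff] at h1
    rw [mem_cesaroDisc_one_iff, not_lt] at h2
    rw [Complex.inv_re, div_eq_one_iff_eq (Complex.normSq_pos.2 h0).ne']
    exact le_antisymm h2 h1
  refine ⟨fun hb => ⟨Subset.antisymm (fun μ hμ => ?_) ?_, hstar⟩,
    fun hb => ⟨Subset.antisymm (hstar ▸ hsub) fun μ hμ => ?_, hstar⟩⟩
  · by_contra hn
    simp only [mem_union, mem_insert_iff, mem_singleton_iff, not_or] at hn
    obtain ⟨⟨h0, h1⟩, h2⟩ := hn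
    have hre := hbd μ h0 (hstar ▸ hsub hμ) h2
    have hz1 : μ⁻¹ ≠ 1 := fun h => h1 (inv_eq_one.1 h)
    exact hμ (mem_resolventSet_cesaro hα_pos hα hα_lim hs_one hs h0 (sub_ne_zero.2 hz1.symm)
      (add_two_sub_ne_zero_of_re_le hre.le)
      (uniformlyStepBounded_cesaroSolve_of_re_eq hα_pos hα hs_one hs_lim hb hre hz1)).1
  · rintro μ ((rfl | rfl) | hμ)
    exacts [hzero, hone, hdisc hμ]
  · by_cases hd : μ ∈ cesaroDisc 1
    · exact hdisc hd
    rcases eq_or_ne μ 0 with rfl | h0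
    · exact hzero
    rcases eq_or_ne μ 1 with rfl | h1
    · exact hone
    exact mem_spectrum_cesaro_of_re_eq hα_pos hα hα_lim hs_one hs hb h0 h1 (hbd μ h0 hμ hd)
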